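/- Graphs are finite multigraphs (parallel edges and self-loops allowed). The Kirchhoff polynomial of $G$ is $\Psi_G=\sum_T\prod_{e\notin T}t_e\in\mathbb{Q}[t_e : e\in E(G)]$, the sum running over all spanning trees $T$ of $G$ (so $\Psi_G=0$ if $G$ is disconnected). Condition 1 holds for an edge $e$ of $G$ if $\Psi_G$ lies in the ideal generated by the partial derivatives $\partial\Psi_{G\smallsetminus e}/\partial t_j$, $j\in E(G)\smallsetminus\{e\}$. The loop number of $G$ is $|E(G)|-|V(G)|+c(G)$, where $c(G)$ is the number of connected components. A source-terminal graph is a graph with two distinct marked vertices, its source and its terminal. The parallel join of two such graphs is their disjoint union with the two sources identified and the two terminals identified; the series join is their disjoint union with the terminal of the first identified with the source of the second. A series-parallel graph is one built from single edges $K_2$ by series and parallel joins; a decomposition tree $\Upsilon$ of it is a rooted tree whose leaves are its edges and whose interior vertices are the series and parallel joins of such a construction. The $\Upsilon$-dual is the series-parallel graph given by the tree obtained from $\Upsilon$ by exchanging all series joins with parallel joins and vice versa. Let $H$ be a source-terminal graph such that one of the following holds. (a) $H$ is a cycle (with at least two vertices; two parallel edges count as a cycle), any two distinct vertices of which are marked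 as source and terminal. (b) There are $n\ge 2$ and source-terminal graphs $H_1^\vee,\dots,H_n^\vee$, each of which is either a path with at least one edge whose two ends are the marked vertices, or a graph having a planar embedding with a face bounded by a Hamiltonian cycle on which the two marked vertices are consecutive, such that their series join $G^\vee$ is a series-parallel graph with at least $4$ vertices, and $H$ is the $\Upsilon^\vee$-dual of $G^\vee$ for some decomposition tree $\Upsilon^\vee$ of $G^\vee$. Let $G$ be any graph, let $f$ be an edge of $G$ that is not a self-loop, with ends $u$ and $v$, and let $\widetilde G$ be obtained from $G$ by deleting $f$ and gluing the source of $H$ to $u$ and the terminal of $H$ to $v$. If the loop number of $\widetilde G$ is at least $2$, then condition 1 holds for every edge $e\in H\subseteq\widetilde G$. -/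

import Mathlib

open scoped Graph

/-! Multigraphs (parallel edges and self-loops allowed) are Mathlib's `Graph α β`: the vertices
lie in `α`, the edges in `β`, and every edge `e` carries a variable `X e` of `MvPolynomial β ℚ`. -/

namespace CondOne

variable {α β : Type*}

/-! ### Trees, Kirchhoff polynomials, condition 1 -/

/-- `G` is connected: it has a vertex and any two vertices are joined by a walk. -/
def IsConn (G : Graph α β) : Prop :=
  V(G).Nonempty ∧ ∀ x ∈ V(G), ∀ y ∈ V(G), Relation.ReflTransGen G.Adj x y

/-- `G` has no cycle: after deleting an edge, its ends are no longer joined by a walk. -/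
def IsAcyclic (G : Graph α β) : Prop :=
  ∀ e x y, G.IsLink e x y → ¬ Relation.ReflTransGen (G.deleteEdges {e}).Adj x y

/-- `T` is (the edge set of) a spanning tree of `G`. -/
structure IsSpanningTree (G : Graph α β) (T : Set β) : Prop where
  subset : T ⊆ E(G)
  conn : IsConn (G.restrict T)
  acyclic : IsAcyclic (G.restrict T)

/-- The Kirchhoff polynomial of a finite graph: the sum over the spanning trees `T` of the product
of the variables of the edges outside `T`. It is `0` if the graph is disconnected. -/
noncomputable def kirchhoff (G : Graph α β) : MvPolynomial β ℚ :=
  ∑ᶠ T ∈ {T : Set β | IsSpanningTree G T}, ∏ᶠ e ∈ E(G) \ T, MvPolynomial.X e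

/-- Condition 1 for the edge `e` of `G`: the Kirchhoff polynomial of `G` lies in the ideal
generated by the partial derivatives of the Kirchhoff polynomial of `G` with `e` deleted. -/
def Condition1 (G : Graph α β) (e : β) : Prop :=
  kirchhoff G ∈ Ideal.span
    ((fun j => MvPolynomial.pderiv j (kirchhoff (G.deleteEdges {e}))) ''
      E(G.deleteEdges {e}))

/-- The number of connected components. -/
noncomputable def numComponents (G : Graph α β) : ℕ :=
  Nat.card (Quot fun x y : V(G) => G.Adj x y)

/-- The loop number (first Betti number) of a finite graph. -/
noncomputable def loopNumber (G : Graph α β) : ℤ :=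
  (E(G).ncard : ℤ) - V(G).ncard + numComponents G

/-! ### Gluing -/

/-- `G` is the union of the edge-disjoint graphs `A` and `B`. -/
structure IsUnion (A B G : Graph α β) : Prop where
  disjoint_edges : Disjoint E(A) E(B)
  vertexSet_eq : V(G) = V(A) ∪ V(B)
  isLink_iff : ∀ e x y, G.IsLink e x y ↔ A.IsLink e x y ∨ B.IsLink e x y

/-- `G` is the parallel join of `A` and `B`, all three with source `s` and terminal `t`:
`A` and `B` have only the two distinct vertices `s` and `t` in common. -/
structure IsParallelJoin (A B G : Graph α β) (s t : α) : Prop where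
  ne : s ≠ t
  inter : V(A) ∩ V(B) = {s, t}
  union : IsUnion A B G

/-- `G`, with source `s` and terminal `t`, is the series join of `A` (source `s`, terminal `w`)
and `B` (source `w`, terminal `t`): `A` and `B` have only the vertex `w` in common. -/
structure IsSeriesJoin (A B G : Graph α β) (s w t : α) : Prop where
  left_ne : s ≠ w
  right_ne : w ≠ t
  left_mem : s ∈ V(A)
  right_mem : t ∈ V(B)
  inter : V(A) ∩ V(B) = {w}
  union : IsUnion A B G

/-- `G'` arises from `G` by replacing the edge `f`, with ends `u ≠ v`, by the graph `H` with
source `u` and terminal `v`: the edge `f` is deleted, and (a copy of) `H`, disjoint from the rest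
of `G` except for its source and terminal, is glued in at `u` and `v`. -/
structure IsReplacement (G : Graph α β) (f : β) (H G' : Graph α β) (u v : α) : Prop where
  isLink : G.IsLink f u v
  join : IsParallelJoin (G.deleteEdges {f}) H G' u v

/-! ### Series-parallel graphs and their decomposition trees -/

/-- Decomposition trees; the leaves are labelled by edges. -/
inductive SPTree (β : Type*) where
  | leaf (e : β) : SPTree β
  | series (l r : SPTree β) : SPTree β
  | parallel (l r : SPTree β) : SPTree β

/-- Exchange series and parallel joins throughout. -/
def SPTree.dual : SPTree β → SPTree β
  | .leaf e => .leaf e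
  | .series l r => .parallel l.dual r.dual
  | .parallel l r => .series l.dual r.dual

/-- `G`, with source `s` and terminal `t`, is (a copy of) the series-parallel graph described by
the decomposition tree. A leaf describes a single edge with distinct ends. -/
inductive Represents : SPTree β → Graph α β → α → α → Prop
  | leaf {e : β} {s t : α} (hst : s ≠ t) :
      Represents (.leaf e) (Graph.banana s t {e}) s t
  | series {l r : SPTree β} {A B G : Graph α β} {s w t : α}
      (hl : Represents l A s w) (hr : Represents r B w t) (h : IsSeriesJoin A B G s w t) :
      Represents (.series l r) G s t
  | parallel {l r : SPTree β} {A B G : Graph α β} {s t : α}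
      (hl : Represents l A s t) (hr : Represents r B s t) (h : IsParallelJoin A B G s t) :
      Represents (.parallel l r) G s t

/-! ### Cycles and paths -/

/-- `G` is a cycle with `n ≥ 1` vertices `x i` and `n` edges `e i` from `x i` to `x (i + 1)`
(a double edge for `n = 2`). -/
def IsCycle (G : Graph α β) : Prop :=
  ∃ n : ℕ, 1 ≤ n ∧ ∃ (x : ZMod n → α) (e : ZMod n → β),
    Function.Injective x ∧ Function.Injective e ∧ V(G) = Set.range x ∧
    ∀ c a b, G.IsLink c a b ↔ ∃ i, c = e i ∧ s(a, b) = s(x i, x (i + 1))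

/-- `G` is a path with `n ≥ 1` edges whose ends are the source `s` and the terminal `t`. -/
def IsPath (G : Graph α β) (s t : α) : Prop :=
  ∃ n : ℕ, 1 ≤ n ∧ ∃ (x : Fin (n + 1) → α) (e : Fin n → β),
    Function.Injective x ∧ Function.Injective e ∧ V(G) = Set.range x ∧
    (∀ c a b, G.IsLink c a b ↔ ∃ i : Fin n, c = e i ∧ s(a, b) = s(x i.castSucc, x i.succ)) ∧
    s = x 0 ∧ t = x (Fin.last n)

/-! ### Planar embeddings -/

/-- A planar embedding of a finite connected graph with at least one edge, given as a rotation
system of Euler characteristic 2. Every edge `e` consists of two darts `(e, false)` and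
`(e, true)`, and `tail` is the vertex at which a dart starts. The permutation `rot` sends a dart
to the next one in the cyclic order around its tail. -/
structure PlanarEmbedding (G : Graph α β) where
  conn : IsConn G
  finite_vertexSet : V(G).Finite
  finite_edgeSet : E(G).Finite
  tail : E(G) × Bool → α
  isLink : ∀ e : E(G), G.IsLink e (tail (e, false)) (tail (e, true))
  rot : Equiv.Perm (E(G) × Bool)
  sameCycle_rot_iff : ∀ d d', rot.SameCycle d d' ↔ tail d = tail d'
  euler : V(G).ncard +
    Nat.card (Quotient (Equiv.Perm.SameCycle.setoid
      ((Equiv.prodCongr (Equiv.refl E(G)) Equiv.boolNot).trans rot))) = E(G).ncard + 2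

/-- The permutation of the darts whose orbits are the faces: traverse the dart, then take the
next dart around the vertex that has been reached. -/
def PlanarEmbedding.face {G : Graph α β} (P : PlanarEmbedding G) : Equiv.Perm (E(G) × Bool) :=
  (Equiv.prodCongr (Equiv.refl E(G)) Equiv.boolNot).trans P.rot

/-- The face that contains the dart `d` is bounded by a Hamiltonian cycle: its boundary walk
visits every vertex exactly once and repeats no edge. -/
def PlanarEmbedding.IsHamiltonianFace {G : Graph α β} (P : PlanarEmbedding G)
    (d : E(G) × Bool) : Prop :=
  Set.BijOn P.tail {d' | P.face.SameCycle d d'} V(G) ∧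
    Set.InjOn Prod.fst {d' | P.face.SameCycle d d'}

/-- `G` has a planar embedding with a Hamiltonian face on which the distinct vertices `s` and `t`
are consecutive, i.e. joined by an edge of the face. -/
def HasHamiltonianFace (G : Graph α β) (s t : α) : Prop :=
  s ≠ t ∧ ∃ (P : PlanarEmbedding G) (d : E(G) × Bool),
    P.IsHamiltonianFace d ∧ G.IsLink d.1 s t

/-! ### The graphs that may be glued in -/

/-- `SeriesOfPieces n G s t`: `G` is the series join of `n ≥ 1` graphs, each of which is a path
between its source and terminal or has a Hamiltonian face on which they are consecutive. -/
inductive SeriesOfPieces : ℕ → Graph α β → α → α → Prop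
  | single {G : Graph α β} {s t : α} (h : HasHamiltonianFace G s t ∨ IsPath G s t) :
      SeriesOfPieces 1 G s t
  | cons {n : ℕ} {A B G : Graph α β} {s w t : α}
      (hA : HasHamiltonianFace A s w ∨ IsPath A s w) (hB : SeriesOfPieces n B w t)
      (h : IsSeriesJoin A B G s w t) : SeriesOfPieces (n + 1) G s t

/-- `H`, with source `u` and terminal `v`, is the dual, with respect to some decomposition tree,
of a series-parallel graph `D` with at least 4 vertices that is a series join of at least two
pieces as above. -/
def IsCoHamiltonian (H : Graph α β) (u v : α) : Prop :=
  ∃ (γ : Type) (D : Graph γ β) (s t : γ) (n : ℕ) (Y : SPTree β),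
    2 ≤ n ∧ SeriesOfPieces n D s t ∧ 4 ≤ V(D).ncard ∧
    Represents Y D s t ∧ Represents Y.dual H u v

end CondOne

namespace CondOne

open MvPolynomial

variable {α β : Type*}

/-! ### Polynomials of series-parallel graphs with a spanning path -/

/-! Write `A` for `G` without `f`, and let `(g, g')` be the generating functions, over complements,
of the spanning trees of `A` and of its spanning two-forests separating `u` from `v`. Gluing in `H`
gives `Ψ = g * p + g' * p'`, where `p` comes from the two-forests of `H` and `p'` from its trees. By
duality (`Represents.complPoly_dual`) `(p, p')` is the pair of tree and two-forest polynomials of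
the dual graph, now over the edges in the tree or forest.

As `Ψ` is linear in each variable, the Kirchhoff polynomial of the graph without `e` is `∂ₑΨ`. Loop
number at least 2 makes its degree positive, so by Euler's identity `∂ₑΨ` lies in the ideal `I` of
condition 1, together with its images under all derivations (`condition1_of_forall_ideal`). It
remains to recover `Ψ` from these.

The dual graph has a spanning path between its terminals, so at each parallel join one side consists
of parallel edges only. Hence its pair is built by series products and by adding parallel edges
(`HamPair`). On such pairs two derivations act (`HamPair.exists_derivations`): the Euler derivation
`E`, with weights `m` and `m - 1`, and some `D` which, up to a common scalar `a`, kills `p` and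
sends `p'` to `p`. Adding a parallel edge `x` is the unipotent change `p ↦ p + x * p'`, under which
the pair `D`, `E` can be corrected to keep its form.

Dually, write `Ψ = M * p + N * p'` with `e` in the part of `(p, p')`. If derivations of the outer
part send `M` to `N` up to scalars, one can descend to `e` and get `Ψ ∈ I`
(`HamPair.mem_ideal_of_context`). The arbitrary graph `A` supplies only its Euler derivation; the
missing one comes from the sibling factor of a series join at the root
(`HamPair.mem_ideal_of_series`). The root is such a join because a series join of at least two
pieces has nonadjacent terminals. A cycle is two arcs in parallel, the dual of two bundles of
parallel edges in series. -/

/-- The pairs `(p, p')` of generating functions of spanning trees and of spanning two-forests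
separating the terminals, for the series-parallel graphs with edge set `S` that have a spanning path
between their terminals. -/
inductive HamPair : Set β → MvPolynomial β ℚ → MvPolynomial β ℚ → Prop
  | edge (e : β) : HamPair {e} (X e) 1
  | series {S T : Set β} {p p' q q' : MvPolynomial β ℚ} (hp : HamPair S p p')
      (hq : HamPair T q q') (h : Disjoint S T) : HamPair (S ∪ T) (p * q) (p * q' + p' * q)
  | thicken {S : Set β} {p p' : MvPolynomial β ℚ} {e : β} (hp : HamPair S p p') (he : e ∉ S) :
      HamPair (insert e S) (p + X e * p') p'

lemma derivation_eq_zero_of_mem_supported {S : Set β}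
    {D : Derivation ℚ (MvPolynomial β ℚ) (MvPolynomial β ℚ)} (hD : ∀ j ∈ S, D (X j) = 0)
    {p : MvPolynomial β ℚ} (hp : p ∈ supported ℚ S) : D p = 0 :=
  derivation_eqOn_supported (D₂ := 0) (fun j hj => by simpa using hD j hj) hp

lemma X_mem_supported_of_mem {S : Set β} {e : β} (he : e ∈ S) :
    (X e : MvPolynomial β ℚ) ∈ supported ℚ S :=
  Algebra.subset_adjoin ⟨e, he, rfl⟩

lemma HamPair.mem_supported {S : Set β} {p p' : MvPolynomial β ℚ} (h : HamPair S p p') :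
    p ∈ supported ℚ S ∧ p' ∈ supported ℚ S := by
  induction h with
  | edge e => exact ⟨X_mem_supported_of_mem rfl, one_mem _⟩
  | @series S T p p' q q' _ _ _ ihp ihq =>
    have hS := supported_mono (R := ℚ) (Set.subset_union_left (s := S) (t := T))
    have hT := supported_mono (R := ℚ) (Set.subset_union_right (s := S) (t := T))
    exact ⟨mul_mem (hS ihp.1) (hT ihq.1),
      add_mem (mul_mem (hS ihp.1) (hT ihq.2)) (mul_mem (hS ihp.2) (hT ihq.1))⟩
  | @thicken S p p' e _ _ ihp =>
    have hS := supported_mono (R := ℚ) (Set.subset_insert e S)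
    exact ⟨add_mem (hS ihp.1) (mul_mem (X_mem_supported_of_mem (Set.mem_insert _ _)) (hS ihp.2)),
      hS ihp.2⟩

/-- Derivations in the variables of `S` that act on `(p, p')` through elementary matrices. -/
lemma HamPair.exists_derivations {S : Set β} {p p' : MvPolynomial β ℚ} (h : HamPair S p p') :
    ∃ (D E : Derivation ℚ (MvPolynomial β ℚ) (MvPolynomial β ℚ)) (a m : MvPolynomial β ℚ),
      (∀ j ∉ S, D (X j) = 0) ∧ (∀ j ∉ S, E (X j) = 0) ∧
      D p = a * p ∧ D p' = a * p' + p ∧ E p = m * p ∧ E p' = (m - 1) * p' := by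
  induction h with
  | edge e =>
    -- With `a = -x`, the requirement `D 1 = a * 1 + x` reads `0 = 0`, and `D x = a * x` forces `-x²
    -- ∂ₓ`.
    refine ⟨(-X e ^ 2 : MvPolynomial β ℚ) • pderiv e, (X e : MvPolynomial β ℚ) • pderiv e,
      -X e, 1, fun j hj => ?_, fun j hj => ?_, ?_, ?_, ?_, ?_⟩
    · simp [pderiv_X_of_ne (show j ≠ e from hj)]
    · simp [pderiv_X_of_ne (show j ≠ e from hj)]
    · simp; ring
    · simp
    · simp
    · simp
  | @series S T p p' q q' hp hq hST ihp ihq =>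
    obtain ⟨D, E, a, m, hD, hE, h1, h2, h3, h4⟩ := ihp
    obtain ⟨-, F, -, n, -, hF, -, -, h7, h8⟩ := ihq
    have hS := fun j (hj : j ∈ S) => hF j (fun h => Set.disjoint_left.1 hST hj h)
    have hT := fun j (hj : j ∈ T) (h : j ∈ S) => Set.disjoint_left.1 hST h hj
    have k1 := derivation_eq_zero_of_mem_supported (fun j hj => hD j (hT j hj)) hq.mem_supported.1
    have k2 := derivation_eq_zero_of_mem_supported (fun j hj => hD j (hT j hj)) hq.mem_supported.2
    have k3 := derivation_eq_zero_of_mem_supported (fun j hj => hE j (hT j hj)) hq.mem_supported.1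
    have k4 := derivation_eq_zero_of_mem_supported (fun j hj => hE j (hT j hj)) hq.mem_supported.2
    have k5 := derivation_eq_zero_of_mem_supported hS hp.mem_supported.1
    have k6 := derivation_eq_zero_of_mem_supported hS hp.mem_supported.2
    -- `D` of the first factor suffices: it kills `q` and `q'` and sends `p * q' + p' * q` to `p *
    -- q` up to the scalar `a`. The Euler derivations must be added.
    refine ⟨D, E + F, a, m + n, fun j hj => hD j fun h => hj (Or.inl h), fun j hj => ?_,
      ?_, ?_, ?_, ?_⟩
    · simp [hE j fun h => hj (Or.inl h), hF j fun h => hj (Or.inr h)]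
    · simp [h1, k1]; ring
    · simp [h1, h2, k1, k2]; ring
    · simp [h3, h7, k3, k5]; ring
    · simp [h3, h4, h7, h8, k3, k4, k5, k6]; ring
  | @thicken S p p' e hp he ihp =>
    obtain ⟨D, E, a, m, hD, hE, h1, h2, h3, h4⟩ := ihp
    have hS : ∀ j ∈ S, pderiv e (X j : MvPolynomial β ℚ) = 0 := fun j hj =>
      pderiv_X_of_ne (fun h => he (h ▸ hj))
    have k1 := derivation_eq_zero_of_mem_supported hS hp.mem_supported.1
    have k2 := derivation_eq_zero_of_mem_supported hS hp.mem_supported.2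
    have hn : ∀ j ∉ insert e S, pderiv e (X j : MvPolynomial β ℚ) = 0 := fun j hj =>
      pderiv_X_of_ne (fun h => hj (Or.inl h))
    -- `D` alone sends `p + x * p'` to `a * (p + x * p') + x * p`. Subtracting `2x E` and `x² ∂ₓ`
    -- turns this into a multiple of `p + x * p'`; the unequal weights of `E` on `p` and `p'` make
    -- it work.
    refine ⟨D - (2 * X e : MvPolynomial β ℚ) • E - (X e ^ 2 : MvPolynomial β ℚ) • pderiv e,
      E + (X e : MvPolynomial β ℚ) • pderiv e, a + X e - 2 * X e * m, m,
      fun j hj => ?_, fun j hj => ?_, ?_, ?_, ?_, ?_⟩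
    · simp [hD j fun h => hj (Or.inr h), hE j fun h => hj (Or.inr h), hn j hj]
    · simp [hE j fun h => hj (Or.inr h), hn j hj]
    · simp [h1, h2, h3, h4, k1, k2, hD e he, hE e he]; ring
    · simp [h2, h4, k2]; ring
    · simp [h3, h4, k1, k2, hE e he]; ring
    · simp [h4, k2]

/-- A graph with polynomial `M * p + N * p'`, of which the part described by `(p, p')` carries the
edge `e`: an ideal that contains `∂ₑ` of the polynomial and all derivatives of it contains the
polynomial, as soon as suitable derivations act on the outer part `(M, N)`. -/
lemma HamPair.mem_ideal_of_context {S : Set β} {p p' : MvPolynomial β ℚ} (h : HamPair S p p')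
    {e : β} (he : e ∈ S) {I : Ideal (MvPolynomial β ℚ)} :
    ∀ {M N : MvPolynomial β ℚ} {D E : Derivation ℚ (MvPolynomial β ℚ) (MvPolynomial β ℚ)}
      {a c : MvPolynomial β ℚ}, M ∈ supported ℚ Sᶜ → N ∈ supported ℚ Sᶜ →
      (∀ j ∈ S, D (X j) = 0) → (∀ j ∈ S, E (X j) = 0) →
      D M = a * M + N → D N = a * N → E M = c * M → E N = (c + 1) * N →
      pderiv e (M * p + N * p') ∈ I →
      (∀ F : Derivation ℚ (MvPolynomial β ℚ) (MvPolynomial β ℚ),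
        F (pderiv e (M * p + N * p')) ∈ I) → M * p + N * p' ∈ I := by
  induction h with
  | edge f =>
    intro M N D E a c hM hN hD hE h1 h2 h3 h4 hI hF
    obtain rfl : e = f := he
    have hz : ∀ j ∈ ({e}ᶜ : Set β), pderiv e (X j : MvPolynomial β ℚ) = 0 := fun j hj =>
      pderiv_X_of_ne hj
    have hM0 := derivation_eq_zero_of_mem_supported hz hM
    have hN0 := derivation_eq_zero_of_mem_supported hz hN
    -- The derivative is `M` itself, so `D M = a * M + N` yields `N ∈ I`.
    have key : pderiv e (M * X e + N * 1) = M := by simp [hM0, hN0]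
    rw [key] at hI hF
    have := hF D
    rw [h1] at this
    have hNI : N ∈ I := by simpa using sub_mem this (I.mul_mem_left a hI)
    simpa using add_mem (I.mul_mem_right (X e) hI) hNI
  | @series S T p p' q q' hp hq hST ihp ihq =>
    intro M N D E a c hM hN hD hE h1 h2 h3 h4 hI hF
    have hSc : (S ∪ T)ᶜ ⊆ Sᶜ := fun j hj h => hj (Or.inl h)
    have hTc : (S ∪ T)ᶜ ⊆ Tᶜ := fun j hj h => hj (Or.inr h)
    have hTS : T ⊆ Sᶜ := fun j hj h => Set.disjoint_left.1 hST h hj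
    have hS' : S ⊆ Tᶜ := fun j hj h => Set.disjoint_left.1 hST hj h
    have hD1 := fun j (hj : j ∈ S) => hD j (Or.inl hj)
    have hD2 := fun j (hj : j ∈ T) => hD j (Or.inr hj)
    have hE1 := fun j (hj : j ∈ S) => hE j (Or.inl hj)
    have hE2 := fun j (hj : j ∈ T) => hE j (Or.inr hj)
    have a1 := derivation_eq_zero_of_mem_supported hD1 hp.mem_supported.1
    have a2 := derivation_eq_zero_of_mem_supported hD1 hp.mem_supported.2
    have a3 := derivation_eq_zero_of_mem_supported hE1 hp.mem_supported.1
    have a4 := derivation_eq_zero_of_mem_supported hE1 hp.mem_supported.2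
    have b1 := derivation_eq_zero_of_mem_supported hD2 hq.mem_supported.1
    have b2 := derivation_eq_zero_of_mem_supported hD2 hq.mem_supported.2
    have b3 := derivation_eq_zero_of_mem_supported hE2 hq.mem_supported.1
    have b4 := derivation_eq_zero_of_mem_supported hE2 hq.mem_supported.2
    rcases he with he | he
    · obtain ⟨-, F, -, m, -, hFv, -, -, h7, h8⟩ := hq.exists_derivations
      have hFM := derivation_eq_zero_of_mem_supported (fun j hj => hFv j (hTc hj)) hM
      have hFN := derivation_eq_zero_of_mem_supported (fun j hj => hFv j (hTc hj)) hN
      have hq1 := supported_mono (R := ℚ) hTS hq.mem_supported.1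
      have hq2 := supported_mono (R := ℚ) hTS hq.mem_supported.2
      have hM' := supported_mono (R := ℚ) hSc hM
      have hN' := supported_mono (R := ℚ) hSc hN
      -- The sibling `(q, q')` is absorbed into the context. The old `D` kills it and still sends
      -- the new `M` to the new `N`; the weights of `E` and `F` add.
      have hEq : M * (p * q) + N * (p * q' + p' * q) = (M * q + N * q') * p + N * q * p' := by ring
      rw [hEq] at hI hF ⊢
      refine ihp he (D := D) (E := E + F) (a := a) (c := c + m)
        (add_mem (mul_mem hM' hq1) (mul_mem hN' hq2)) (mul_mem hN' hq1) hD1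
        (fun j hj => ?_) ?_ ?_ ?_ ?_ hI hF
      · simp [hE1 j hj, hFv j (hS' hj)]
      · simp [h1, h2, b1, b2]; ring
      · simp [h2, b1]; ring
      · simp [h3, h4, b3, b4, h7, h8, hFM, hFN]; ring
      · simp [h4, b3, h7, hFN]; ring
    · obtain ⟨-, F, -, m, -, hFv, -, -, h7, h8⟩ := hp.exists_derivations
      have hFM := derivation_eq_zero_of_mem_supported (fun j hj => hFv j (hSc hj)) hM
      have hFN := derivation_eq_zero_of_mem_supported (fun j hj => hFv j (hSc hj)) hN
      have hp1 := supported_mono (R := ℚ) hS' hp.mem_supported.1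
      have hp2 := supported_mono (R := ℚ) hS' hp.mem_supported.2
      have hM' := supported_mono (R := ℚ) hTc hM
      have hN' := supported_mono (R := ℚ) hTc hN
      have hEq : M * (p * q) + N * (p * q' + p' * q) = (M * p + N * p') * q + N * p * q' := by ring
      rw [hEq] at hI hF ⊢
      refine ihq he (D := D) (E := E + F) (a := a) (c := c + m)
        (add_mem (mul_mem hM' hp1) (mul_mem hN' hp2)) (mul_mem hN' hp1) hD2
        (fun j hj => ?_) ?_ ?_ ?_ ?_ hI hF
      · simp [hE2 j hj, hFv j (hTS hj)]
      · simp [h1, h2, a1, a2]; ring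
      · simp [h2, a1]; ring
      · simp [h3, h4, a3, a4, h7, h8, hFM, hFN]; ring
      · simp [h4, a3, h7, hFN]; ring
  | @thicken S p p' f hp hf ihp =>
    intro M N D E a c hM hN hD hE h1 h2 h3 h4 hI hF
    have hSc : (insert f S)ᶜ ⊆ Sᶜ := fun j hj h => hj (Or.inr h)
    have hD1 := fun j (hj : j ∈ S) => hD j (Or.inr hj)
    have hE1 := fun j (hj : j ∈ S) => hE j (Or.inr hj)
    have hDf := hD f (Or.inl rfl)
    have hEf := hE f (Or.inl rfl)
    have hfc : ∀ j ∈ (insert f S)ᶜ, pderiv f (X j : MvPolynomial β ℚ) = 0 := fun j hj =>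
      pderiv_X_of_ne (fun h => hj (Or.inl h))
    have hfS : ∀ j ∈ S, pderiv f (X j : MvPolynomial β ℚ) = 0 := fun j hj =>
      pderiv_X_of_ne (fun h => hf (h ▸ hj))
    have hfM := derivation_eq_zero_of_mem_supported hfc hM
    have hfN := derivation_eq_zero_of_mem_supported hfc hN
    have a2 := derivation_eq_zero_of_mem_supported hD1 hp.mem_supported.2
    rcases he with rfl | he
    · have hfp := derivation_eq_zero_of_mem_supported hfS hp.mem_supported.1
      have hfp' := derivation_eq_zero_of_mem_supported hfS hp.mem_supported.2
      obtain ⟨F, -, b, -, hFv, -, h5, h6, -, -⟩ := hp.exists_derivations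
      have hFM := derivation_eq_zero_of_mem_supported (fun j hj => hFv j (hSc hj)) hM
      have key : pderiv e (M * (p + X e * p') + N * p') = M * p' := by
        simp [hfM, hfN, hfp, hfp']
      rw [key] at hI hF
      -- Starting from `M * p'`, the derivation of the context isolates `N * p'`, and the one of
      -- `(p, p')` isolates `M * p`.
      have hx : N * p' ∈ I := by
        have : D (M * p') - a * (M * p') = N * p' := by simp [h1, a2]; ring
        exact this ▸ sub_mem (hF D) (I.mul_mem_left a hI)
      have hy : M * p ∈ I := by
        have : F (M * p') - b * (M * p') = M * p := by simp [h6, hFM]; ring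
        exact this ▸ sub_mem (hF F) (I.mul_mem_left b hI)
      have hEq : M * (p + X e * p') + N * p' = M * p + X e * (M * p') + N * p' := by ring
      rw [hEq]
      exact add_mem (add_mem hy (I.mul_mem_left _ hI)) hx
    · have hEq : M * (p + X f * p') + N * p' = M * p + (M * X f + N) * p' := by ring
      rw [hEq] at hI hF ⊢
      have hM' := supported_mono (R := ℚ) hSc hM
      have hN' := supported_mono (R := ℚ) hSc hN
      have hXf : (X f : MvPolynomial β ℚ) ∈ supported ℚ Sᶜ := X_mem_supported_of_mem hf
      -- Moving the edge into the context is the transposed unipotent change `N ↦ N + x * M`, hence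
      -- the same correcting terms.
      refine ihp he (D := D - (2 * X f : MvPolynomial β ℚ) • E -
          (X f ^ 2 : MvPolynomial β ℚ) • pderiv f)
        (E := E + (X f : MvPolynomial β ℚ) • pderiv f) (a := a - X f - 2 * X f * c) (c := c)
        hM' (add_mem (mul_mem hM' hXf) hN') (fun j hj => ?_) (fun j hj => ?_)
        ?_ ?_ ?_ ?_ hI hF
      · simp [hD1 j hj, hE1 j hj, hfS j hj]
      · simp [hE1 j hj, hfS j hj]
      · simp [h1, h3, hfM]; ring
      · simp [h1, h2, h3, h4, hDf, hEf, hfM, hfN]; ring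
      · simp [h3, hfM]
      · simp [h3, h4, hEf, hfM, hfN]; ring

/-- The outer pair `(g, g')` comes with weights only. The context of `(p, p')` is `(g * q + g' * q',
g' * q)`, and the derivation `D` of `(q, q')` sends its first entry to its second up to a scalar. -/
lemma HamPair.mem_ideal_of_series {S T : Set β} {p p' q q' : MvPolynomial β ℚ}
    (hp : HamPair S p p') (hq : HamPair T q q') (hST : Disjoint S T) {g g' : MvPolynomial β ℚ}
    (hg : g ∈ supported ℚ (S ∪ T)ᶜ) (hg' : g' ∈ supported ℚ (S ∪ T)ᶜ)
    {E : Derivation ℚ (MvPolynomial β ℚ) (MvPolynomial β ℚ)} {c : MvPolynomial β ℚ}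
    (hE : ∀ j ∈ S ∪ T, E (X j) = 0) (hEg : E g = c * g) (hEg' : E g' = (c + 1) * g')
    {e : β} (he : e ∈ S) {I : Ideal (MvPolynomial β ℚ)}
    (hI : pderiv e (g * (p * q) + g' * (p * q' + p' * q)) ∈ I)
    (hF : ∀ F : Derivation ℚ (MvPolynomial β ℚ) (MvPolynomial β ℚ),
      F (pderiv e (g * (p * q) + g' * (p * q' + p' * q))) ∈ I) :
    g * (p * q) + g' * (p * q' + p' * q) ∈ I := by
  obtain ⟨D, F, a, m, hDv, hFv, h5, h6, h7, h8⟩ := hq.exists_derivations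
  have hTS : T ⊆ Sᶜ := fun j hj h => Set.disjoint_left.1 hST h hj
  have hS' : S ⊆ Tᶜ := fun j hj h => Set.disjoint_left.1 hST hj h
  have hSc : (S ∪ T)ᶜ ⊆ Sᶜ := fun j hj h => hj (Or.inl h)
  have hTc : (S ∪ T)ᶜ ⊆ Tᶜ := fun j hj h => hj (Or.inr h)
  have hq1 := supported_mono (R := ℚ) hTS hq.mem_supported.1
  have hq2 := supported_mono (R := ℚ) hTS hq.mem_supported.2
  have hM' := supported_mono (R := ℚ) hSc hg
  have hN' := supported_mono (R := ℚ) hSc hg'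
  have hE2 := fun j (hj : j ∈ T) => hE j (Or.inr hj)
  have b1 := derivation_eq_zero_of_mem_supported hE2 hq.mem_supported.1
  have b2 := derivation_eq_zero_of_mem_supported hE2 hq.mem_supported.2
  have c1 := derivation_eq_zero_of_mem_supported (fun j hj => hDv j (hTc hj)) hg
  have c2 := derivation_eq_zero_of_mem_supported (fun j hj => hDv j (hTc hj)) hg'
  have c3 := derivation_eq_zero_of_mem_supported (fun j hj => hFv j (hTc hj)) hg
  have c4 := derivation_eq_zero_of_mem_supported (fun j hj => hFv j (hTc hj)) hg'
  have hEq : g * (p * q) + g' * (p * q' + p' * q) = (g * q + g' * q') * p + g' * q * p' := by ring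
  rw [hEq] at hI hF ⊢
  refine hp.mem_ideal_of_context he (D := D) (E := E + F) (a := a) (c := c + m)
    (add_mem (mul_mem hM' hq1) (mul_mem hN' hq2)) (mul_mem hN' hq1)
    (fun j hj => hDv j (hS' hj)) (fun j hj => ?_) ?_ ?_ ?_ ?_ hI hF
  · simp [hE j (Or.inl hj), hFv j (hS' hj)]
  · simp [h5, h6, c1, c2]; ring
  · simp [h5, c2]; ring
  · simp [hEg, hEg', h7, h8, b1, b2, c3, c4]; ring
  · simp [hEg', h7, b1, c4]; ring

/-! ### Generating functions of complements -/

open Classical in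
/-- The sum over the `T ⊆ E` with the property `P` of the product of the variables in `E \ T`. -/
noncomputable def complPoly (E : Finset β) (P : Finset β → Prop) : MvPolynomial β ℚ :=
  ∑ T ∈ E.powerset with P T, ∏ e ∈ E \ T, X e

lemma complPoly_congr {E : Finset β} {P Q : Finset β → Prop} (h : ∀ T ⊆ E, P T ↔ Q T) :
    complPoly E P = complPoly E Q := by
  classical
  unfold complPoly
  congr 1
  exact Finset.filter_congr fun T hT => h T (Finset.mem_powerset.1 hT)

lemma complPoly_or {E : Finset β} {P Q : Finset β → Prop} (h : ∀ T ⊆ E, P T → ¬ Q T) :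
    complPoly E (fun T => P T ∨ Q T) = complPoly E P + complPoly E Q := by
  classical
  unfold complPoly
  rw [← Finset.sum_union (Finset.disjoint_filter.2 fun T hT => h T (Finset.mem_powerset.1 hT))]
  refine Finset.sum_congr ?_ fun _ _ => rfl
  ext T
  simp only [Finset.mem_filter, Finset.mem_union]
  tauto

open Classical in
lemma complPoly_mul {E F : Finset β} (hEF : Disjoint E F) (P Q : Finset β → Prop) :
    complPoly E P * complPoly F Q = complPoly (E ∪ F) fun T => P (T ∩ E) ∧ Q (T ∩ F) := by
  unfold complPoly
  rw [Finset.sum_mul_sum, ← Finset.sum_product']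
  have hd := Finset.disjoint_left.1 hEF
  have key : ∀ A ⊆ E, ∀ B ⊆ F, (A ∪ B) ∩ E = A ∧ (A ∪ B) ∩ F = B := by
    intro A hA B hB
    constructor
    · ext x
      have := @hA x; have := @hB x; have := @hd x
      simp only [Finset.mem_inter, Finset.mem_union]; tauto
    · ext x
      have := @hA x; have := @hB x; have := @hd x
      simp only [Finset.mem_inter, Finset.mem_union]; tauto
  refine Finset.sum_nbij' (fun p => p.1 ∪ p.2) (fun T => (T ∩ E, T ∩ F)) ?_ ?_ ?_ ?_ ?_
  · rintro ⟨A, B⟩ h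
    simp only [Finset.mem_product, Finset.mem_filter, Finset.mem_powerset] at h ⊢
    obtain ⟨h1, h2⟩ := key A h.1.1 B h.2.1
    rw [h1, h2]
    exact ⟨Finset.union_subset_union h.1.1 h.2.1, h.1.2, h.2.2⟩
  · intro T h
    simp only [Finset.mem_product, Finset.mem_filter, Finset.mem_powerset] at h ⊢
    exact ⟨⟨Finset.inter_subset_right, h.2.1⟩, Finset.inter_subset_right, h.2.2⟩
  · rintro ⟨A, B⟩ h
    simp only [Finset.mem_product, Finset.mem_filter, Finset.mem_powerset] at h ⊢
    obtain ⟨h1, h2⟩ := key A h.1.1 B h.2.1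
    rw [h1, h2]
  · intro T h
    simp only [Finset.mem_filter, Finset.mem_powerset] at h ⊢
    rw [← Finset.inter_union_distrib_left, Finset.inter_eq_left.2 h.1]
  · rintro ⟨A, B⟩ h
    simp only [Finset.mem_product, Finset.mem_filter, Finset.mem_powerset] at h ⊢
    rw [← Finset.prod_union]
    · refine Finset.prod_congr ?_ fun _ _ => rfl
      ext x
      have := @h.1.1 x; have := @h.2.1 x; have := @hd x
      simp only [Finset.mem_sdiff, Finset.mem_union]; tauto
    · exact Finset.disjoint_of_subset_left Finset.sdiff_subset
        (Finset.disjoint_of_subset_right Finset.sdiff_subset hEF)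

lemma complPoly_mem_supported (E : Finset β) (P : Finset β → Prop) :
    complPoly E P ∈ supported ℚ (E : Set β) := by
  classical
  exact sum_mem fun T _ => prod_mem fun e he =>
    X_mem_supported_of_mem (Finset.mem_sdiff.1 he).1

lemma derivation_prod_X {S : Finset β}
    {D : Derivation ℚ (MvPolynomial β ℚ) (MvPolynomial β ℚ)} (hD : ∀ j ∈ S, D (X j) = X j) :
    D (∏ e ∈ S, X e) = (S.card : MvPolynomial β ℚ) * ∏ e ∈ S, X e := by
  classical
  induction S using Finset.induction_on with
  | empty => simp
  | insert a S ha ih =>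
    rw [Finset.prod_insert ha, Derivation.leibniz, ih fun j hj => hD j (Finset.mem_insert_of_mem hj),
      hD a (Finset.mem_insert_self _ _), Finset.card_insert_of_notMem ha]
    simp only [smul_eq_mul]
    push_cast
    ring

/-- Euler's identity. -/
lemma derivation_complPoly {E : Finset β} {P : Finset β → Prop} {c : MvPolynomial β ℚ}
    {D : Derivation ℚ (MvPolynomial β ℚ) (MvPolynomial β ℚ)} (hD : ∀ j ∈ E, D (X j) = X j)
    (hP : ∀ T ⊆ E, P T → (E.card : MvPolynomial β ℚ) - T.card = c) :
    D (complPoly E P) = c * complPoly E P := by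
  classical
  unfold complPoly
  rw [map_sum, Finset.mul_sum]
  refine Finset.sum_congr rfl fun T hT => ?_
  simp only [Finset.mem_filter, Finset.mem_powerset] at hT
  rw [derivation_prod_X fun j hj => hD j (Finset.mem_sdiff.1 hj).1, ← hP T hT.1 hT.2,
    Finset.card_sdiff_of_subset hT.1, Nat.cast_sub (Finset.card_le_card hT.1)]

open Classical in
-- All monomials are squarefree, and `X e` divides exactly those with `e ∉ T`.
lemma pderiv_complPoly {E : Finset β} (P : Finset β → Prop) {e : β} (he : e ∈ E) :
    pderiv e (complPoly E P) = complPoly (E.erase e) P := by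
  unfold complPoly
  rw [map_sum]
  symm
  have hX : ∀ S : Finset β, e ∉ S →
      pderiv e (∏ j ∈ S, X j : MvPolynomial β ℚ) = 0 := fun S hS =>
    derivation_eq_zero_of_mem_supported (S := (S : Set β))
      (fun j hj => pderiv_X_of_ne fun h : j = e => hS (h ▸ hj))
      (prod_mem fun j hj => X_mem_supported_of_mem hj)
  refine Finset.sum_subset_zero_on_sdiff ?_ ?_ ?_
  · intro T hT
    simp only [Finset.mem_filter, Finset.mem_powerset] at hT ⊢
    exact ⟨hT.1.trans (Finset.erase_subset _ _), hT.2⟩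
  · intro T hT
    simp only [Finset.mem_sdiff, Finset.mem_filter, Finset.mem_powerset, not_and] at hT
    apply hX
    intro h
    refine hT.2 (fun x hx => Finset.mem_erase.2 ⟨?_, hT.1.1 hx⟩) hT.1.2
    rintro rfl
    exact (Finset.mem_sdiff.1 h).2 hx
  · intro T hT
    simp only [Finset.mem_filter, Finset.mem_powerset] at hT
    have heT : e ∉ T := fun h => (Finset.mem_erase.1 (hT.1 h)).1 rfl
    have : E \ T = insert e (E.erase e \ T) := by
      ext x
      by_cases hx : x = e
      · subst hx; simp [he, heT]
      · simp [hx]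
    have h' : e ∉ E.erase e \ T := by simp
    rw [this, Finset.prod_insert h', Derivation.leibniz, hX _ h', pderiv_X_self]
    simp

/-! ### Potentials -/

/-- `f` takes the same value at the two ends of each edge in `T`. -/
def Respects (G : Graph α β) (T : Set β) (f : α → ℚ) : Prop :=
  ∀ e ∈ T, ∀ x y, G.IsLink e x y → f x = f y

/-- The edges in `T` connect the vertices of `G`. -/
def Connects (G : Graph α β) (T : Set β) : Prop :=
  ∀ f, Respects G T f → ∀ x ∈ V(G), ∀ y ∈ V(G), f x = f y

/-- The edges in `T` connect the vertices of `G` once `s` and `t` are identified. -/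
def ConnectsMod (G : Graph α β) (s t : α) (T : Set β) : Prop :=
  ∀ f, Respects G T f → f s = f t → ∀ x ∈ V(G), ∀ y ∈ V(G), f x = f y

/-- Spanning trees of finite graphs, by the number of their edges. -/
def IsTree (G : Graph α β) (T : Finset β) : Prop :=
  Connects G T ∧ T.card + 1 = V(G).ncard

/-- Spanning forests with two components, which separate `s` and `t`. -/
def IsTwoForest (G : Graph α β) (s t : α) (T : Finset β) : Prop :=
  ConnectsMod G s t T ∧ T.card + 2 = V(G).ncard

lemma Connects.connectsMod {G : Graph α β} {T : Set β} (h : Connects G T) (s t : α) :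
    ConnectsMod G s t T := fun f hf _ => h f hf

/-- Rank-nullity for the coboundary `f ↦ f (a i) - f (b i)`, whose kernel is contained in the
constants. -/
lemma card_le_of_const {ι W : Type*} [Fintype ι] [Fintype W] (a b : ι → W)
    (h : ∀ f : W → ℚ, (∀ i, f (a i) = f (b i)) → ∀ x y, f x = f y) :
    Fintype.card W ≤ Fintype.card ι + 1 := by
  let L : (W → ℚ) →ₗ[ℚ] (ι → ℚ) :=
    { toFun := fun f i => f (a i) - f (b i)
      map_add' := fun f g => by ext i; simp; ring
      map_smul' := fun c f => by ext i; simp; ring }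
  have h1 := L.finrank_range_add_finrank_ker
  have h2 : Module.finrank ℚ (LinearMap.range L) ≤ Fintype.card ι := by
    simpa using Submodule.finrank_le (LinearMap.range L)
  have h3 : LinearMap.ker L ≤ Submodule.span ℚ {fun _ => (1 : ℚ)} := by
    intro f hf
    have hf' := h f fun i => sub_eq_zero.1 (congrFun (LinearMap.mem_ker.1 hf) i)
    rw [Submodule.mem_span_singleton]
    rcases isEmpty_or_nonempty W with hW | ⟨⟨w⟩⟩
    · exact ⟨0, Subsingleton.elim _ _⟩
    · exact ⟨f w, by ext x; simpa using hf' w x⟩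
  have h4 := (Submodule.finrank_mono h3).trans (finrank_span_le_card (R := ℚ) _)
  simp at h1 h4
  omega

/-- The given functions make the coboundary surjective, while its kernel contains the constants. -/
lemma card_le_of_separating {ι W : Type*} [Fintype ι] [Fintype W] [Nonempty W] (a b : ι → W)
    (h : ∀ i, ∃ f : W → ℚ, f (a i) ≠ f (b i) ∧ ∀ j ≠ i, f (a j) = f (b j)) :
    Fintype.card ι + 1 ≤ Fintype.card W := by
  classical
  let L : (W → ℚ) →ₗ[ℚ] (ι → ℚ) :=
    { toFun := fun f i => f (a i) - f (b i)
      map_add' := fun f g => by ext i; simp; ring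
      map_smul' := fun c f => by ext i; simp; ring }
  have h1 := L.finrank_range_add_finrank_ker
  have h2 : LinearMap.range L = ⊤ := by
    rw [eq_top_iff, ← (Pi.basisFun ℚ ι).span_eq, Submodule.span_le]
    rintro _ ⟨i, rfl⟩
    obtain ⟨f, hf, hf'⟩ := h i
    refine ⟨(f (a i) - f (b i))⁻¹ • f, ?_⟩
    ext j
    rw [map_smul]
    by_cases hj : j = i
    · subst hj
      simp [L, inv_mul_cancel₀ (sub_ne_zero.2 hf)]
    · simp [L, hf' j hj, hj]
  have h3 : 1 ≤ Module.finrank ℚ (LinearMap.ker L) := by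
    rw [Nat.one_le_iff_ne_zero, ← Nat.pos_iff_ne_zero, Module.finrank_pos_iff_exists_ne_zero]
    refine ⟨⟨fun _ => 1, by ext i; simp [L]⟩, fun h => ?_⟩
    obtain ⟨w⟩ := ‹Nonempty W›
    have := congrFun (congrArg Subtype.val h) w
    simp at this
  rw [h2] at h1
  simp at h1
  omega

lemma respects_iff_of_isLink {G : Graph α β} {T : Finset β} {a b : T → V(G)}
    (hab : ∀ e : T, G.IsLink e (a e) (b e)) {f : α → ℚ} :
    Respects G T f ↔ ∀ e, f (a e) = f (b e) := by
  refine ⟨fun h e => h e e.2 _ _ (hab e), fun h e he x y hxy => ?_⟩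
  rcases hxy.eq_and_eq_or_eq_and_eq (hab ⟨e, he⟩) with ⟨rfl, rfl⟩ | ⟨rfl, rfl⟩
  · exact h ⟨e, he⟩
  · exact (h ⟨e, he⟩).symm

lemma exists_ends {G : Graph α β} {T : Finset β} (hT : (T : Set β) ⊆ E(G)) :
    ∃ a b : T → V(G), ∀ e : T, G.IsLink e (a e) (b e) := by
  have : ∀ e : T, ∃ p : V(G) × V(G), G.IsLink e p.1 p.2 := fun e => by
    obtain ⟨x, y, h⟩ := G.exists_isLink_of_mem_edgeSet (hT e.2)
    exact ⟨(⟨x, h.left_mem⟩, ⟨y, h.right_mem⟩), h⟩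
  choose p hp using this
  exact ⟨fun e => (p e).1, fun e => (p e).2, hp⟩

lemma exists_extension {W : Set α} (f : W → ℚ) : ∃ g : α → ℚ, ∀ x : W, g x = f x := by
  classical
  exact ⟨fun x => if h : x ∈ W then f ⟨x, h⟩ else 0, fun x => by simp⟩

lemma Connects.ncard_le {G : Graph α β} {T : Finset β} (h : Connects G T)
    (hT : (T : Set β) ⊆ E(G)) (hV : V(G).Finite) : V(G).ncard ≤ T.card + 1 := by
  have := hV.fintype
  obtain ⟨a, b, hab⟩ := exists_ends hT
  have := card_le_of_const a b fun f hf x y => by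
    obtain ⟨g, hg⟩ := exists_extension f
    rw [← hg, ← hg]
    exact h g ((respects_iff_of_isLink hab).2 fun e => by rw [hg, hg, hf]) x x.2 y y.2
  rwa [Fintype.card_coe, ← Nat.card_eq_fintype_card, Nat.card_coe_set_eq] at this

/-- Identifying `s` and `t` amounts to one more edge between them: the index `none` of `Option T`.
-/
lemma ConnectsMod.ncard_le {G : Graph α β} {s t : α} {T : Finset β} (h : ConnectsMod G s t T)
    (hT : (T : Set β) ⊆ E(G)) (hV : V(G).Finite) (hs : s ∈ V(G)) (ht : t ∈ V(G)) :
    V(G).ncard ≤ T.card + 2 := by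
  have := hV.fintype
  obtain ⟨a, b, hab⟩ := exists_ends hT
  have := card_le_of_const (fun o : Option T => o.elim ⟨s, hs⟩ a)
    (fun o : Option T => o.elim ⟨t, ht⟩ b) fun f hf x y => by
      obtain ⟨g, hg⟩ := exists_extension f
      rw [← hg, ← hg]
      refine h g ((respects_iff_of_isLink hab).2 fun e => ?_) ?_ x x.2 y y.2
      · rw [hg, hg]; exact hf (some e)
      · have := hf none
        rw [Option.elim_none, Option.elim_none, ← hg, ← hg] at this
        exact this
  rwa [Fintype.card_option, Fintype.card_coe, ← Nat.card_eq_fintype_card,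
    Nat.card_coe_set_eq] at this

lemma respects_inter {A : Graph α β} {T : Set β} {f : α → ℚ} :
    Respects A (T ∩ E(A)) f ↔ Respects A T f :=
  ⟨fun h e he x y hxy => h e ⟨he, hxy.edge_mem⟩ x y hxy, fun h e he => h e he.1⟩

lemma connects_inter {A : Graph α β} {T : Set β} :
    Connects A (T ∩ E(A)) ↔ Connects A T := by
  simp only [Connects, respects_inter]

lemma connectsMod_inter {A : Graph α β} {s t : α} {T : Set β} :
    ConnectsMod A s t (T ∩ E(A)) ↔ ConnectsMod A s t T := by
  simp only [ConnectsMod, respects_inter]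

lemma ConnectsMod.symm {A : Graph α β} {s t : α} {T : Set β} (h : ConnectsMod A s t T) :
    ConnectsMod A t s T := fun f hf hst => h f hf hst.symm

/-! ### Spanning trees by counting -/

open Relation in
lemma Respects.eq_of_reflTransGen {G : Graph α β} {T : Set β} {f : α → ℚ} (hf : Respects G T f)
    {x y : α} (h : ReflTransGen (G.restrict T).Adj x y) : f x = f y := by
  induction h with
  | refl => rfl
  | tail _ h ih =>
    obtain ⟨e, he⟩ := h
    rw [ih]
    simp only [Graph.restrict_isLink] at he
    exact hf e (by tauto) _ _ (by tauto)

open Relation Classical in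
lemma respects_reachable (G : Graph α β) (T : Set β) (x : α) :
    Respects G T fun y => if ReflTransGen (G.restrict T).Adj x y then 1 else 0 := by
  intro e he y z hyz
  have h1 : (G.restrict T).Adj y z := ⟨e, by simp [hyz, he]⟩
  have : ReflTransGen (G.restrict T).Adj x y ↔ ReflTransGen (G.restrict T).Adj x z :=
    ⟨fun h => h.tail h1, fun h => h.tail h1.symm⟩
  simp only [this]

lemma isConn_restrict_iff {G : Graph α β} (hV : V(G).Nonempty) {T : Set β} :
    IsConn (G.restrict T) ↔ Connects G T := by
  classical
  constructor
  · rintro ⟨-, h⟩ f hf x hx y hy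
    exact hf.eq_of_reflTransGen (h x hx y hy)
  · intro h
    refine ⟨hV, fun x hx y hy => ?_⟩
    have := h _ (respects_reachable G T x) x hx y hy
    by_contra hn
    simp [hn, Relation.ReflTransGen.refl] at this

lemma restrict_deleteEdges_singleton (G : Graph α β) (T : Set β) (e : β) :
    (G.restrict T).deleteEdges {e} = G.restrict (T \ {e}) := by
  ext
  · rfl
  · simp only [Graph.deleteEdges_isLink, Graph.restrict_isLink, Set.mem_sdiff, Set.mem_singleton_iff]
    tauto

/-- In an acyclic `T`, the vertices reachable from one end of an edge without using it have an
indicator that separates this edge only, which bounds the number of edges. Conversely, an edge on a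
cycle could be dropped from `T`, against `Connects.ncard_le`. -/
lemma isSpanningTree_iff {G : Graph α β} (hV : V(G).Finite) (hne : V(G).Nonempty)
    {T : Finset β} (hT : (T : Set β) ⊆ E(G)) : IsSpanningTree G T ↔ IsTree G T := by
  classical
  have := hV.fintype
  constructor
  · rintro ⟨-, hc, ha⟩
    rw [isConn_restrict_iff hne] at hc
    refine ⟨hc, le_antisymm ?_ (hc.ncard_le hT hV)⟩
    obtain ⟨a, b, hab⟩ := exists_ends hT
    have : Nonempty V(G) := hne.to_subtype
    have := card_le_of_separating a b fun i => by
      have hi := ha i (a i) (b i) (by simp [hab i])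
      rw [restrict_deleteEdges_singleton] at hi
      refine ⟨fun y => if Relation.ReflTransGen (G.restrict (T \ {i.1})).Adj (a i) y
        then 1 else 0, ?_, fun j hj => ?_⟩
      · simp [hi, Relation.ReflTransGen.refl]
      · exact respects_reachable G (T \ {i.1}) (a i) j ⟨j.2, fun h => hj (Subtype.ext h)⟩ _ _ (hab j)
    rwa [Fintype.card_coe, ← Nat.card_eq_fintype_card, Nat.card_coe_set_eq] at this
  · rintro ⟨hc, hcard⟩
    refine ⟨hT, (isConn_restrict_iff hne).2 hc, fun e x y he h => ?_⟩
    rw [restrict_deleteEdges_singleton] at h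
    simp only [Graph.restrict_isLink] at he
    have heT : e ∈ T := by simpa using (show e ∈ (T : Set β) by tauto)
    have hxy : G.IsLink e x y := by tauto
    have hc' : Connects G (T.erase e : Finset β) := by
      intro f hf
      refine hc f fun e' he' z w hzw => ?_
      rw [Finset.coe_erase] at hf
      by_cases hee : e' = e
      · subst hee
        have := hf.eq_of_reflTransGen h
        rcases hzw.eq_and_eq_or_eq_and_eq hxy with ⟨rfl, rfl⟩ | ⟨rfl, rfl⟩
        · exact this
        · exact this.symm
      · exact hf e' ⟨he', hee⟩ z w hzw
    have h1 := hc'.ncard_le ((Finset.coe_subset.2 (Finset.erase_subset _ _)).trans hT) hV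
    have h2 := Finset.card_erase_add_one heT
    omega

lemma kirchhoff_eq {G : Graph α β} (hV : V(G).Finite) (hne : V(G).Nonempty) {E : Finset β}
    (hE : (E : Set β) = E(G)) : kirchhoff G = complPoly E (IsTree G) := by
  classical
  have h : {T : Set β | IsSpanningTree G T} =
      (fun T : Finset β => (T : Set β)) '' ({T ∈ E.powerset | IsTree G T} : Finset (Finset β)) := by
    ext T
    simp only [Set.mem_ofPred_eq, Set.mem_image, Finset.mem_coe, Finset.mem_filter,
      Finset.mem_powerset]
    constructor
    · intro hT
      have hfin : T.Finite := E.finite_toSet.subset (hE ▸ hT.subset)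
      refine ⟨hfin.toFinset, ⟨?_, ?_⟩, hfin.coe_toFinset⟩
      · rw [← Finset.coe_subset, hfin.coe_toFinset, hE]
        exact hT.subset
      · rw [← isSpanningTree_iff hV hne (by rw [hfin.coe_toFinset]; exact hT.subset),
          hfin.coe_toFinset]
        exact hT
    · rintro ⟨S, ⟨hS, hS'⟩, rfl⟩
      exact (isSpanningTree_iff hV hne (hE ▸ Finset.coe_subset.2 hS)).2 hS'
  unfold kirchhoff complPoly
  rw [h, finsum_mem_image Finset.coe_injective.injOn, finsum_mem_coe_finset]
  refine Finset.sum_congr rfl fun T _ => ?_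
  rw [← hE, ← Finset.coe_sdiff, finprod_mem_coe_finset]

/-! ### Joins -/

lemma IsUnion.respects_iff {A B G : Graph α β} (h : IsUnion A B G) {T : Set β} {f : α → ℚ} :
    Respects G T f ↔ Respects A T f ∧ Respects B T f := by
  simp only [Respects, h.isLink_iff]
  exact ⟨fun h => ⟨fun e he x y hxy => h e he x y (Or.inl hxy),
    fun e he x y hxy => h e he x y (Or.inr hxy)⟩,
    fun h e he x y hxy => hxy.elim (h.1 e he x y) (h.2 e he x y)⟩

lemma Respects.congr {A : Graph α β} {T : Set β} {f g : α → ℚ} (h : Respects A T f)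
    (hfg : ∀ x ∈ V(A), g x = f x) : Respects A T g := fun e he x y hxy => by
  rw [hfg x hxy.left_mem, hfg y hxy.right_mem, h e he x y hxy]

lemma Respects.affine {A : Graph α β} {T : Set β} {f : α → ℚ} (h : Respects A T f) (c d : ℚ) :
    Respects A T fun x => c * f x + d := fun e he x y hxy => by
  simp only [h e he x y hxy]

lemma respects_const (A : Graph α β) (T : Set β) (c : ℚ) : Respects A T fun _ => c :=
  fun _ _ _ _ _ => rfl

lemma IsUnion.exists_glue {A B G : Graph α β} (h : IsUnion A B G) {T : Set β} {f g : α → ℚ}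
    (hf : Respects A T f) (hg : Respects B T g) (hfg : ∀ x ∈ V(A) ∩ V(B), f x = g x) :
    ∃ k, Respects G T k ∧ (∀ x ∈ V(A), k x = f x) ∧ ∀ x ∈ V(B), k x = g x := by
  classical
  have h1 : ∀ x ∈ V(A), (if x ∈ V(A) then f x else g x) = f x := fun x hx => by simp [hx]
  have h2 : ∀ x ∈ V(B), (if x ∈ V(A) then f x else g x) = g x := fun x hx => by
    by_cases hA : x ∈ V(A)
    · simp [hA, hfg x ⟨hA, hx⟩]
    · simp [hA]
  exact ⟨_, h.respects_iff.2 ⟨hf.congr h1, hg.congr h2⟩, h1, h2⟩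

lemma IsUnion.symm {A B G : Graph α β} (h : IsUnion A B G) : IsUnion B A G :=
  ⟨h.disjoint_edges.symm, by rw [h.vertexSet_eq, Set.union_comm], fun e x y => by
    rw [h.isLink_iff, or_comm]⟩

lemma IsUnion.edgeSet_eq {A B G : Graph α β} (h : IsUnion A B G) : E(G) = E(A) ∪ E(B) := by
  ext e
  simp only [Set.mem_union, Graph.edge_mem_iff_exists_isLink, h.isLink_iff, exists_or]

lemma IsParallelJoin.symm {A B G : Graph α β} {s t : α} (h : IsParallelJoin A B G s t) :
    IsParallelJoin B A G s t := ⟨h.ne, by rw [Set.inter_comm, h.inter], h.union.symm⟩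

lemma connects_of_forall {A : Graph α β} {T : Set β} {s : α}
    (h : ∀ f, Respects A T f → ∀ x ∈ V(A), f x = f s) : Connects A T :=
  fun f hf x hx y hy => (h f hf x hx).trans (h f hf y hy).symm

lemma connectsMod_of_forall {A : Graph α β} {T : Set β} {s t r : α}
    (h : ∀ f, Respects A T f → f s = f t → ∀ x ∈ V(A), f x = f r) : ConnectsMod A s t T :=
  fun f hf hst x hx y hy => (h f hf hst x hx).trans (h f hf hst y hy).symm

/-- If identifying `s` and `t` makes `T` connecting but `T` does not connect `A`, then some
potential separates `s` and `t`. -/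
lemma ConnectsMod.exists_potential {A : Graph α β} {T : Set β} {s t : α}
    (h : ConnectsMod A s t T) (h' : ¬ Connects A T) (c d : ℚ) :
    ∃ f, Respects A T f ∧ f s = c ∧ f t = d := by
  simp only [Connects, not_forall] at h'
  obtain ⟨f, hf, x, hx, y, hy, hxy⟩ := h'
  have hst : f s ≠ f t := fun hst => hxy (h f hf hst x hx y hy)
  have hst' : f t - f s ≠ 0 := sub_ne_zero.2 hst.symm
  refine ⟨_, hf.affine ((d - c) / (f t - f s)) (c - (d - c) / (f t - f s) * f s), ?_, ?_⟩
  · ring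
  · field_simp; ring

section Parallel

variable {A B G : Graph α β} {s t : α} {T : Set β}

lemma IsParallelJoin.mem (h : IsParallelJoin A B G s t) :
    s ∈ V(A) ∧ t ∈ V(A) ∧ s ∈ V(B) ∧ t ∈ V(B) := by
  have hs : s ∈ V(A) ∩ V(B) := by rw [h.inter]; simp
  have ht : t ∈ V(A) ∩ V(B) := by rw [h.inter]; simp
  exact ⟨hs.1, ht.1, hs.2, ht.2⟩

lemma IsParallelJoin.connects_of_left (h : IsParallelJoin A B G s t)
    (hA : Connects A T) (hB : ConnectsMod B s t T) : Connects G T := by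
  obtain ⟨h1, h2, h3, h4⟩ := h.mem
  refine connects_of_forall (s := s) fun f hf x hx => ?_
  rw [h.union.respects_iff] at hf
  rw [h.union.vertexSet_eq] at hx
  rcases hx with hx | hx
  · exact hA f hf.1 x hx s h1
  · exact hB f hf.2 (hA f hf.1 s h1 t h2) x hx s h3

/-- A potential on `A` with equal values at `s` and `t` extends to `B` by a constant. -/
lemma IsParallelJoin.connectsMod_left_of_connectsMod (h : IsParallelJoin A B G s t)
    (hG : ConnectsMod G s t T) : ConnectsMod A s t T := by
  intro f hf hst x hx y hy
  obtain ⟨k, hk, hkA, -⟩ := h.union.exists_glue hf (respects_const B T (f s)) (by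
    rw [h.inter]; rintro z (rfl | rfl) <;> simp [hst])
  obtain ⟨h1, h2, -, -⟩ := h.mem
  rw [← hkA x hx, ← hkA y hy]
  exact hG k hk (by rw [hkA s h1, hkA t h2, hst]) x (h.union.vertexSet_eq ▸ Or.inl hx)
    y (h.union.vertexSet_eq ▸ Or.inl hy)

lemma IsParallelJoin.connectsMod_iff (h : IsParallelJoin A B G s t) :
    ConnectsMod G s t T ↔ ConnectsMod A s t T ∧ ConnectsMod B s t T := by
  refine ⟨fun hG => ⟨h.connectsMod_left_of_connectsMod hG,
    h.symm.connectsMod_left_of_connectsMod hG⟩, fun ⟨hA, hB⟩ => ?_⟩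
  obtain ⟨h1, -, h3, -⟩ := h.mem
  refine connectsMod_of_forall (r := s) fun f hf hst x hx => ?_
  rw [h.union.respects_iff] at hf
  rw [h.union.vertexSet_eq] at hx
  rcases hx with hx | hx
  · exact hA f hf.1 hst x hx s h1
  · exact hB f hf.2 hst x hx s h3

/-- Otherwise both sides carry potentials with values 0 at `s` and 1 at `t`, which glue to a
nonconstant one. -/
lemma IsParallelJoin.connects_or (h : IsParallelJoin A B G s t) (hG : Connects G T) :
    Connects A T ∨ Connects B T := by
  by_contra! hn
  obtain ⟨hA, hB⟩ := h.connectsMod_iff.1 (hG.connectsMod s t)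
  obtain ⟨f, hf, hfs, hft⟩ := hA.exists_potential hn.1 0 1
  obtain ⟨g, hg, hgs, hgt⟩ := hB.exists_potential hn.2 0 1
  obtain ⟨k, hk, hkA, -⟩ := h.union.exists_glue hf hg (by
    rw [h.inter]; rintro z (rfl | rfl) <;> simp [*])
  obtain ⟨h1, h2, -, -⟩ := h.mem
  have := hG k hk s (h.union.vertexSet_eq ▸ Or.inl h1) t (h.union.vertexSet_eq ▸ Or.inl h2)
  rw [hkA s h1, hkA t h2, hfs, hft] at this
  exact zero_ne_one this

lemma IsParallelJoin.ncard (h : IsParallelJoin A B G s t) (hA : V(A).Finite) (hB : V(B).Finite) :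
    V(G).ncard + 2 = V(A).ncard + V(B).ncard := by
  have := Set.ncard_union_add_ncard_inter V(A) V(B) hA hB
  rwa [h.inter, Set.ncard_pair h.ne, ← h.union.vertexSet_eq] at this

end Parallel

section Series

variable {A B G : Graph α β} {s w t : α} {T : Set β}

lemma IsSeriesJoin.mem (h : IsSeriesJoin A B G s w t) : w ∈ V(A) ∧ w ∈ V(B) := by
  have : w ∈ V(A) ∩ V(B) := by rw [h.inter]; simp
  exact this

lemma IsSeriesJoin.symm (h : IsSeriesJoin A B G s w t) : IsSeriesJoin B A G t w s :=
  ⟨h.right_ne.symm, h.left_ne.symm, h.right_mem, h.left_mem, by rw [Set.inter_comm, h.inter],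
    h.union.symm⟩

lemma IsSeriesJoin.connects_left (h : IsSeriesJoin A B G s w t) (hG : Connects G T) :
    Connects A T := by
  intro f hf x hx y hy
  obtain ⟨k, hk, hkA, -⟩ := h.union.exists_glue hf (respects_const B T (f w)) (by
    rw [h.inter]; rintro z rfl; rfl)
  rw [← hkA x hx, ← hkA y hy]
  exact hG k hk x (h.union.vertexSet_eq ▸ Or.inl hx) y (h.union.vertexSet_eq ▸ Or.inl hy)

lemma IsSeriesJoin.connects_iff (h : IsSeriesJoin A B G s w t) :
    Connects G T ↔ Connects A T ∧ Connects B T := by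
  refine ⟨fun hG => ⟨h.connects_left hG, h.symm.connects_left hG⟩, fun ⟨hA, hB⟩ => ?_⟩
  refine connects_of_forall (s := w) fun f hf x hx => ?_
  rw [h.union.respects_iff] at hf
  rw [h.union.vertexSet_eq] at hx
  rcases hx with hx | hx
  · exact hA f hf.1 x hx w h.mem.1
  · exact hB f hf.2 x hx w h.mem.2

lemma IsSeriesJoin.connectsMod_left (h : IsSeriesJoin A B G s w t) (hG : ConnectsMod G s t T) :
    ConnectsMod A s w T := by
  intro f hf hsw x hx y hy
  obtain ⟨k, hk, hkA, hkB⟩ := h.union.exists_glue hf (respects_const B T (f w)) (by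
    rw [h.inter]; rintro z rfl; rfl)
  rw [← hkA x hx, ← hkA y hy]
  exact hG k hk (by rw [hkA s h.left_mem, hkB t h.right_mem, hsw])
    x (h.union.vertexSet_eq ▸ Or.inl hx) y (h.union.vertexSet_eq ▸ Or.inl hy)

lemma IsSeriesJoin.connectsMod_of_left (h : IsSeriesJoin A B G s w t) (hA : Connects A T)
    (hB : ConnectsMod B w t T) : ConnectsMod G s t T := by
  refine connectsMod_of_forall (r := w) fun f hf hst x hx => ?_
  rw [h.union.respects_iff] at hf
  rw [h.union.vertexSet_eq] at hx
  rcases hx with hx | hx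
  · exact hA f hf.1 x hx w h.mem.1
  · exact hB f hf.2 ((hA f hf.1 w h.mem.1 s h.left_mem).trans hst) x hx w h.mem.2

/-- Otherwise potentials with value 0 at `w` and 1 at the outer terminals glue to a nonconstant one
that agrees at `s` and `t`. -/
lemma IsSeriesJoin.connects_or (h : IsSeriesJoin A B G s w t) (hG : ConnectsMod G s t T) :
    Connects A T ∨ Connects B T := by
  by_contra! hn
  obtain ⟨f, hf, hfs, hfw⟩ := (h.connectsMod_left hG).exists_potential hn.1 1 0
  obtain ⟨g, hg, hgt, hgw⟩ :=
    (h.symm.connectsMod_left hG.symm).exists_potential hn.2 1 0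
  obtain ⟨k, hk, hkA, hkB⟩ := h.union.exists_glue hf hg (by
    rw [h.inter]; rintro z rfl; rw [hfw, hgw])
  have := hG k hk (by rw [hkA s h.left_mem, hkB t h.right_mem, hfs, hgt]) s
    (h.union.vertexSet_eq ▸ Or.inl h.left_mem) w (h.union.vertexSet_eq ▸ Or.inl h.mem.1)
  rw [hkA s h.left_mem, hkA w h.mem.1, hfs, hfw] at this
  exact one_ne_zero this

lemma IsSeriesJoin.ncard (h : IsSeriesJoin A B G s w t) (hA : V(A).Finite) (hB : V(B).Finite) :
    V(G).ncard + 1 = V(A).ncard + V(B).ncard := by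
  have := Set.ncard_union_add_ncard_inter V(A) V(B) hA hB
  rwa [h.inter, Set.ncard_singleton, ← h.union.vertexSet_eq] at this

end Series

/-! ### Kirchhoff polynomials of joins -/

section Polynomials

variable {A B G : Graph α β} {s w t : α} {E F : Finset β}

open Classical in
lemma connects_inter_finset {T : Finset β} (hE : (E : Set β) = E(A)) :
    Connects A (T ∩ E : Finset β) ↔ Connects A T := by
  rw [Finset.coe_inter, hE, connects_inter]

open Classical in
lemma connectsMod_inter_finset {T : Finset β} (hE : (E : Set β) = E(A)) :
    ConnectsMod A s t (T ∩ E : Finset β) ↔ ConnectsMod A s t T := by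
  rw [Finset.coe_inter, hE, connectsMod_inter]

open Classical in
lemma coe_inter_subset {T : Finset β} (hE : (E : Set β) = E(A)) :
    ((T ∩ E : Finset β) : Set β) ⊆ E(A) := by
  rw [← hE]; exact Finset.coe_subset.2 Finset.inter_subset_right

open Classical in
lemma card_inter_add_card_inter (hEF : Disjoint E F) {T : Finset β} (hT : T ⊆ E ∪ F) :
    (T ∩ E).card + (T ∩ F).card = T.card := by
  rw [← Finset.card_union_of_disjoint, ← Finset.inter_union_distrib_left, Finset.inter_eq_left.2 hT]
  exact Finset.disjoint_of_subset_left Finset.inter_subset_right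
    (Finset.disjoint_of_subset_right Finset.inter_subset_right hEF)

lemma IsUnion.disjoint_finset (h : IsUnion A B G) (hE : (E : Set β) = E(A))
    (hF : (F : Set β) = E(B)) : Disjoint E F := by
  rw [← Finset.disjoint_coe, hE, hF]; exact h.disjoint_edges

open Classical in
-- A spanning tree joins `s` to `t` inside exactly one side and is a separating two-forest on the
-- other. The lower bounds for the edge numbers of both sides add up to the exact total, so both are
-- attained; the same count excludes overlap of the two cases.
lemma IsParallelJoin.complPoly_isTree (h : IsParallelJoin A B G s t) (hE : (E : Set β) = E(A))
    (hF : (F : Set β) = E(B)) (hA : V(A).Finite) (hB : V(B).Finite) :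
    complPoly (E ∪ F) (IsTree G) = complPoly E (IsTree A) * complPoly F (IsTwoForest B s t) +
      complPoly E (IsTwoForest A s t) * complPoly F (IsTree B) := by
  have hd := h.union.disjoint_finset hE hF
  rw [complPoly_mul hd, complPoly_mul hd, ← complPoly_or]
  · refine complPoly_congr fun T hT => ?_
    have hc := card_inter_add_card_inter hd hT
    have hn := h.ncard hA hB
    obtain ⟨h1, h2, h3, h4⟩ := h.mem
    simp only [IsTree, IsTwoForest]
    constructor
    · rintro ⟨hG, hcard⟩
      obtain ⟨hA', hB'⟩ := h.connectsMod_iff.1 (hG.connectsMod s t)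
      rw [← connectsMod_inter_finset hE] at hA'
      rw [← connectsMod_inter_finset hF] at hB'
      have k1 := hA'.ncard_le (coe_inter_subset hE) hA h1 h2
      have k2 := hB'.ncard_le (coe_inter_subset hF) hB h3 h4
      rcases h.connects_or hG with hA'' | hB''
      · rw [← connects_inter_finset hE] at hA''
        have k3 := hA''.ncard_le (coe_inter_subset hE) hA
        exact Or.inl ⟨⟨hA'', by omega⟩, hB', by omega⟩
      · rw [← connects_inter_finset hF] at hB''
        have k3 := hB''.ncard_le (coe_inter_subset hF) hB
        exact Or.inr ⟨⟨hA', by omega⟩, hB'', by omega⟩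
    · rw [connects_inter_finset hE, connects_inter_finset hF, connectsMod_inter_finset hE,
        connectsMod_inter_finset hF]
      rintro (⟨⟨hA', _⟩, hB', _⟩ | ⟨⟨hA', _⟩, hB', _⟩)
      · exact ⟨h.connects_of_left hA' hB', by omega⟩
      · exact ⟨h.symm.connects_of_left hB' hA', by omega⟩
  · rintro T - ⟨⟨-, k1⟩, -⟩ ⟨⟨-, k2⟩, -⟩
    omega

open Classical in
lemma IsParallelJoin.complPoly_isTwoForest (h : IsParallelJoin A B G s t)
    (hE : (E : Set β) = E(A)) (hF : (F : Set β) = E(B)) (hA : V(A).Finite) (hB : V(B).Finite) :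
    complPoly (E ∪ F) (IsTwoForest G s t) =
      complPoly E (IsTwoForest A s t) * complPoly F (IsTwoForest B s t) := by
  have hd := h.union.disjoint_finset hE hF
  rw [complPoly_mul hd]
  refine complPoly_congr fun T hT => ?_
  have hc := card_inter_add_card_inter hd hT
  have hn := h.ncard hA hB
  obtain ⟨h1, h2, h3, h4⟩ := h.mem
  simp only [IsTwoForest]
  rw [h.connectsMod_iff, ← connectsMod_inter_finset hE, ← connectsMod_inter_finset hF]
  constructor
  · rintro ⟨⟨hA', hB'⟩, hcard⟩
    have k1 := hA'.ncard_le (coe_inter_subset hE) hA h1 h2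
    have k2 := hB'.ncard_le (coe_inter_subset hF) hB h3 h4
    exact ⟨⟨hA', by omega⟩, hB', by omega⟩
  · rintro ⟨⟨hA', _⟩, hB', _⟩
    exact ⟨⟨hA', hB'⟩, by omega⟩

open Classical in
lemma IsSeriesJoin.complPoly_isTree (h : IsSeriesJoin A B G s w t) (hE : (E : Set β) = E(A))
    (hF : (F : Set β) = E(B)) (hA : V(A).Finite) (hB : V(B).Finite) :
    complPoly (E ∪ F) (IsTree G) = complPoly E (IsTree A) * complPoly F (IsTree B) := by
  have hd := h.union.disjoint_finset hE hF
  rw [complPoly_mul hd]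
  refine complPoly_congr fun T hT => ?_
  have hc := card_inter_add_card_inter hd hT
  have hn := h.ncard hA hB
  simp only [IsTree]
  rw [h.connects_iff, ← connects_inter_finset hE, ← connects_inter_finset hF]
  constructor
  · rintro ⟨⟨hA', hB'⟩, hcard⟩
    have k1 := hA'.ncard_le (coe_inter_subset hE) hA
    have k2 := hB'.ncard_le (coe_inter_subset hF) hB
    exact ⟨⟨hA', by omega⟩, hB', by omega⟩
  · rintro ⟨⟨hA', _⟩, hB', _⟩
    exact ⟨⟨hA', hB'⟩, by omega⟩

open Classical in
-- The forest is disconnected in exactly one of the two factors; the edge count is as for parallel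
-- joins.
lemma IsSeriesJoin.complPoly_isTwoForest (h : IsSeriesJoin A B G s w t)
    (hE : (E : Set β) = E(A)) (hF : (F : Set β) = E(B)) (hA : V(A).Finite) (hB : V(B).Finite) :
    complPoly (E ∪ F) (IsTwoForest G s t) =
      complPoly E (IsTree A) * complPoly F (IsTwoForest B w t) +
      complPoly E (IsTwoForest A s w) * complPoly F (IsTree B) := by
  have hd := h.union.disjoint_finset hE hF
  rw [complPoly_mul hd, complPoly_mul hd, ← complPoly_or]
  · refine complPoly_congr fun T hT => ?_
    have hc := card_inter_add_card_inter hd hT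
    have hn := h.ncard hA hB
    simp only [IsTree, IsTwoForest]
    constructor
    · rintro ⟨hG, hcard⟩
      have hA' := h.connectsMod_left hG
      have hB' := (h.symm.connectsMod_left hG.symm).symm
      rw [← connectsMod_inter_finset hE] at hA'
      rw [← connectsMod_inter_finset hF] at hB'
      have k1 := hA'.ncard_le (coe_inter_subset hE) hA h.left_mem h.mem.1
      have k2 := hB'.ncard_le (coe_inter_subset hF) hB h.mem.2 h.right_mem
      rcases h.connects_or hG with hA'' | hB''
      · rw [← connects_inter_finset hE] at hA''
        have k3 := hA''.ncard_le (coe_inter_subset hE) hA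
        exact Or.inl ⟨⟨hA'', by omega⟩, hB', by omega⟩
      · rw [← connects_inter_finset hF] at hB''
        have k3 := hB''.ncard_le (coe_inter_subset hF) hB
        exact Or.inr ⟨⟨hA', by omega⟩, hB'', by omega⟩
    · rw [connects_inter_finset hE, connects_inter_finset hF, connectsMod_inter_finset hE,
        connectsMod_inter_finset hF]
      rintro (⟨⟨hA', _⟩, hB', _⟩ | ⟨⟨hA', _⟩, hB', _⟩)
      · exact ⟨h.connectsMod_of_left hA' hB', by omega⟩
      · exact ⟨(h.symm.connectsMod_of_left hB' hA'.symm).symm, by omega⟩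
  · rintro T - ⟨⟨-, k1⟩, -⟩ ⟨⟨-, k2⟩, -⟩
    omega

lemma complPoly_isTree_banana (e : β) (hst : s ≠ t) :
    complPoly {e} (IsTree (Graph.banana s t {e})) = 1 := by
  classical
  have h : ∀ T ⊆ ({e} : Finset β), IsTree (Graph.banana s t {e}) T ↔ T = {e} := by
    intro T hT
    simp only [IsTree, Graph.vertexSet_banana, Set.ncard_pair hst]
    constructor
    · rintro ⟨-, h⟩
      exact Finset.eq_of_subset_of_card_le hT (by rw [Finset.card_singleton]; omega)
    · rintro rfl
      refine ⟨connects_of_forall (s := s) fun f hf x hx => ?_, by simp⟩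
      have := hf e (by simp) s t (by simp)
      rcases hx with rfl | rfl
      · rfl
      · exact this.symm
  rw [complPoly_congr h, complPoly, Finset.sum_filter,
    Finset.sum_eq_single_of_mem {e} (by simp) (by intro b _ hb; simp [hb])]
  simp

lemma complPoly_isTwoForest_banana (e : β) (hst : s ≠ t) :
    complPoly {e} (IsTwoForest (Graph.banana s t {e}) s t) = X e := by
  classical
  have h : ∀ T ⊆ ({e} : Finset β), IsTwoForest (Graph.banana s t {e}) s t T ↔ T = ∅ := by
    intro T hT
    simp only [IsTwoForest, Graph.vertexSet_banana, Set.ncard_pair hst]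
    constructor
    · rintro ⟨-, h⟩
      simpa using h
    · rintro rfl
      refine ⟨connectsMod_of_forall (r := s) fun f hf hfst x hx => ?_, by simp⟩
      rcases hx with rfl | rfl
      · rfl
      · exact hfst.symm
  rw [complPoly_congr h, complPoly, Finset.sum_filter,
    Finset.sum_eq_single_of_mem ∅ (by simp) (by intro b _ hb; simp [hb])]
  simp

end Polynomials

/-! ### Kirchhoff polynomials of series-parallel graphs -/

/-- The edges of a decomposition tree. -/
def SPTree.edges : SPTree β → Set β
  | .leaf e => {e}
  | .series l r => l.edges ∪ r.edges
  | .parallel l r => l.edges ∪ r.edges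

/-- The generating functions of the spanning trees and of the spanning two-forests that separate
the terminals, in terms of the decomposition tree. -/
noncomputable def SPTree.polys : SPTree β → MvPolynomial β ℚ × MvPolynomial β ℚ
  | .leaf e => (X e, 1)
  | .series l r => (l.polys.1 * r.polys.1, l.polys.1 * r.polys.2 + l.polys.2 * r.polys.1)
  | .parallel l r => (l.polys.1 * r.polys.2 + l.polys.2 * r.polys.1, l.polys.2 * r.polys.2)

lemma SPTree.edges_dual (Y : SPTree β) : Y.dual.edges = Y.edges := by
  induction Y <;> simp_all [SPTree.edges, SPTree.dual]

lemma Represents.edgeSet_eq {Y : SPTree β} {G : Graph α β} {s t : α} (h : Represents Y G s t) :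
    E(G) = Y.edges := by
  induction h with
  | leaf => rfl
  | series _ _ h ihl ihr => rw [h.union.edgeSet_eq, ihl, ihr]; rfl
  | parallel _ _ h ihl ihr => rw [h.union.edgeSet_eq, ihl, ihr]; rfl

lemma Represents.finite_vertexSet {Y : SPTree β} {G : Graph α β} {s t : α}
    (h : Represents Y G s t) : V(G).Finite := by
  induction h with
  | leaf => simp
  | series _ _ h ihl ihr => rw [h.union.vertexSet_eq]; exact ihl.union ihr
  | parallel _ _ h ihl ihr => rw [h.union.vertexSet_eq]; exact ihl.union ihr

lemma Represents.mem {Y : SPTree β} {G : Graph α β} {s t : α} (h : Represents Y G s t) :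
    s ∈ V(G) ∧ t ∈ V(G) := by
  induction h with
  | leaf => simp
  | series _ _ h ihl ihr => rw [h.union.vertexSet_eq]; exact ⟨Or.inl ihl.1, Or.inr ihr.2⟩
  | parallel _ _ h ihl ihr => rw [h.union.vertexSet_eq]; exact ⟨Or.inl ihl.1, Or.inl ihl.2⟩

/-- Complementation and the exchange of series with parallel joins both swap the roles of trees and
two-forests, so the recursions for `H` are those of `SPTree.polys` for `Y`. -/
lemma Represents.complPoly_dual {Y : SPTree β} {H : Graph α β} {u v : α}
    (h : Represents Y.dual H u v) : ∃ E : Finset β, (E : Set β) = E(H) ∧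
      complPoly E (IsTwoForest H u v) = Y.polys.1 ∧ complPoly E (IsTree H) = Y.polys.2 := by
  classical
  induction Y generalizing H u v with
  | leaf e =>
    cases h with
    | leaf hst =>
      exact ⟨{e}, by simp, complPoly_isTwoForest_banana e hst, complPoly_isTree_banana e hst⟩
  | series l r ihl ihr =>
    cases h with
    | parallel hl hr h =>
      obtain ⟨E, hE, h1, h2⟩ := ihl hl
      obtain ⟨F, hF, h3, h4⟩ := ihr hr
      refine ⟨E ∪ F, by rw [h.union.edgeSet_eq, ← hE, ← hF, Finset.coe_union], ?_, ?_⟩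
      · rw [h.complPoly_isTwoForest hE hF hl.finite_vertexSet hr.finite_vertexSet, h1, h3]; rfl
      · rw [h.complPoly_isTree hE hF hl.finite_vertexSet hr.finite_vertexSet, h1, h2, h3, h4,
          SPTree.polys]
        ring
  | parallel l r ihl ihr =>
    cases h with
    | series hl hr h =>
      obtain ⟨E, hE, h1, h2⟩ := ihl hl
      obtain ⟨F, hF, h3, h4⟩ := ihr hr
      refine ⟨E ∪ F, by rw [h.union.edgeSet_eq, ← hE, ← hF, Finset.coe_union], ?_, ?_⟩
      · rw [h.complPoly_isTwoForest hE hF hl.finite_vertexSet hr.finite_vertexSet, h1, h2, h3, h4,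
          SPTree.polys]
        ring
      · rw [h.complPoly_isTree hE hF hl.finite_vertexSet hr.finite_vertexSet, h2, h4]; rfl

/-! ### Decomposition trees of graphs with a spanning path -/

/-- The tree describes parallel edges. -/
def SPTree.IsBanana : SPTree β → Prop
  | .leaf _ => True
  | .series _ _ => False
  | .parallel l r => l.IsBanana ∧ r.IsBanana

/-- The tree describes a graph with a spanning path between its terminals. -/
def SPTree.IsHam : SPTree β → Prop
  | .leaf _ => True
  | .series l r => l.IsHam ∧ r.IsHam
  | .parallel l r => l.IsHam ∧ r.IsBanana ∨ l.IsBanana ∧ r.IsHam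

lemma SPTree.IsBanana.isHam {Y : SPTree β} (h : Y.IsBanana) : Y.IsHam := by
  induction Y with
  | leaf e => trivial
  | series l r => exact h.elim
  | parallel l r ihl _ => exact Or.inl ⟨ihl h.1, h.2⟩

/-- The parallel edges are added one at a time by `HamPair.thicken`; `H` serves to certify that
their labels are distinct. -/
lemma HamPair.parallel {Y : SPTree β} (hY : Y.IsBanana) {H : Graph α β} {u v : α}
    (hH : Represents Y.dual H u v) {S : Set β} {p p' : MvPolynomial β ℚ} (h : HamPair S p p')
    (hS : Disjoint S Y.edges) :
    HamPair (S ∪ Y.edges) (p * Y.polys.2 + p' * Y.polys.1) (p' * Y.polys.2) := by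
  induction Y generalizing S p p' H u v with
  | leaf e =>
    convert h.thicken (e := e) (Set.disjoint_singleton_right.1 hS) using 1
    · rw [SPTree.edges, Set.union_singleton]
    · simp only [SPTree.polys]; ring
    · simp only [SPTree.polys]; ring
  | series l r => exact hY.elim
  | parallel l r ihl ihr =>
    cases hH with
    | series hl hr hj =>
      have hlr := hj.union.disjoint_edges
      rw [hl.edgeSet_eq, hr.edgeSet_eq, SPTree.edges_dual, SPTree.edges_dual] at hlr
      rw [SPTree.edges, Set.disjoint_union_right] at hS
      convert ihr hY.2 hr (ihl hY.1 hl h hS.1) (Set.disjoint_union_left.2 ⟨hS.2, hlr⟩) using 1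
      · rw [SPTree.edges, Set.union_assoc]
      · simp only [SPTree.polys]; ring
      · simp only [SPTree.polys]; ring

lemma SPTree.IsHam.hamPair {Y : SPTree β} (hY : Y.IsHam) {H : Graph α β} {u v : α}
    (hH : Represents Y.dual H u v) : HamPair Y.edges Y.polys.1 Y.polys.2 := by
  induction Y generalizing H u v with
  | leaf e => exact .edge e
  | series l r ihl ihr =>
    cases hH with
    | parallel hl hr hj =>
      have hlr := hj.union.disjoint_edges
      rw [hl.edgeSet_eq, hr.edgeSet_eq, SPTree.edges_dual, SPTree.edges_dual] at hlr
      exact .series (ihl hY.1 hl) (ihr hY.2 hr) hlr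
  | parallel l r ihl ihr =>
    cases hH with
    | series hl hr hj =>
      have hlr := hj.union.disjoint_edges
      rw [hl.edgeSet_eq, hr.edgeSet_eq, SPTree.edges_dual, SPTree.edges_dual] at hlr
      rcases hY with hY | hY
      · exact (ihl hY.1 hl).parallel hY.2 hr hlr
      · convert (ihr hY.2 hr).parallel hY.1 hl hlr.symm using 1
        · rw [SPTree.edges, Set.union_comm]
        · simp only [SPTree.polys]; ring
        · simp only [SPTree.polys]; ring

/-! ### Spanning paths -/

/-- There is a path from `x` to `z` in the relation `r` with vertex set `S`. -/
inductive SpanPath (r : α → α → Prop) : Set α → α → α → Prop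
  | nil (x : α) : SpanPath r {x} x x
  | cons {S : Set α} {x y z : α} (h : r x y) (hp : SpanPath r S y z) (hx : x ∉ S) :
      SpanPath r (insert x S) x z

namespace SpanPath

variable {r r' : α → α → Prop} {S T : Set α} {x y z : α}

lemma left_mem (h : SpanPath r S x z) : x ∈ S := by
  cases h <;> simp

lemma right_mem (h : SpanPath r S x z) : z ∈ S := by
  induction h with
  | nil => rfl
  | cons _ _ _ ih => exact Or.inr ih

lemma mono (hr : ∀ a b, r a b → r' a b) (h : SpanPath r S x z) : SpanPath r' S x z := by
  induction h with
  | nil x => exact .nil x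
  | cons h _ hx ih => exact .cons (hr _ _ h) ih hx

lemma append (h : SpanPath r S x y) (h' : SpanPath r T y z) (hST : S ∩ T ⊆ {y}) :
    SpanPath r (S ∪ T) x z := by
  induction h with
  | nil x => rwa [Set.union_eq_right.2 (Set.singleton_subset_iff.2 h'.left_mem)]
  | cons h hp hx ih =>
    rw [Set.insert_union]
    refine .cons h (ih h' fun a ha => hST ⟨Or.inr ha.1, ha.2⟩) ?_
    rintro (hxS | hxT)
    · exact hx hxS
    · have := hST ⟨Or.inl rfl, hxT⟩
      rw [Set.mem_singleton_iff] at this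
      exact hx (this ▸ hp.right_mem)

lemma reverse (hr : ∀ a b, r a b → r b a) (h : SpanPath r S x z) : SpanPath r S z x := by
  induction h with
  | nil x => exact .nil x
  | @cons S x y z h hp hx ih =>
    have hyx : y ∉ ({x} : Set α) := by rintro rfl; exact hx hp.left_mem
    have := ih.append (.cons (hr _ _ h) (.nil x) hyx) (by
      rintro a ⟨ha, rfl | rfl⟩
      · rfl
      · exact (hx ha).elim)
    rwa [Set.union_insert, Set.union_singleton,
      Set.insert_eq_of_mem (Set.mem_insert_of_mem _ hp.left_mem)] at this

lemma of_sequence {p : ℕ → α} {n : ℕ} (hp : Set.InjOn p (Set.Iic n))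
    (h : ∀ i < n, r (p i) (p (i + 1))) : SpanPath r (p '' Set.Iic n) (p 0) (p n) := by
  induction n generalizing p with
  | zero =>
    have : p '' Set.Iic 0 = {p 0} := by
      ext; simp [eq_comm]
    rw [this]
    exact .nil _
  | succ n ih =>
    have := ih (p := fun i => p (i + 1))
      (fun i hi j hj hij => Nat.succ_injective
        (hp (Nat.succ_le_succ hi) (Nat.succ_le_succ hj) hij))
      fun i hi => h (i + 1) (Nat.succ_lt_succ hi)
    have hS : p '' Set.Iic (n + 1) = insert (p 0) ((fun i => p (i + 1)) '' Set.Iic n) := by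
      ext a
      simp only [Set.mem_image, Set.mem_Iic, Set.mem_insert_iff]
      constructor
      · rintro ⟨_ | i, hi, rfl⟩
        · exact Or.inl rfl
        · exact Or.inr ⟨i, by omega, rfl⟩
      · rintro (rfl | ⟨i, hi, rfl⟩)
        · exact ⟨0, by omega, rfl⟩
        · exact ⟨i + 1, by omega, rfl⟩
    rw [hS]
    refine .cons (h 0 n.succ_pos) this ?_
    rintro ⟨i, hi, hi'⟩
    have := hp (Set.mem_Iic.2 (Nat.succ_le_succ hi)) (Set.mem_Iic.2 (Nat.zero_le _)) hi'
    omega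

end SpanPath

lemma IsUnion.adj_iff {A B G : Graph α β} (h : IsUnion A B G) {x y : α} :
    G.Adj x y ↔ A.Adj x y ∨ B.Adj x y := by
  simp only [Graph.Adj, h.isLink_iff, exists_or]

/-! ### Spanning paths in the two sides of a join -/

section Splitting

variable {A B G : Graph α β} {s w t : α}

/-- Sides can be changed only at `s` or `t`; the path avoids `s` and stops at `t`. -/
lemma IsParallelJoin.spanPath_left_of_notMem (h : IsParallelJoin A B G s t) {S : Set α} {x : α}
    (hp : SpanPath G.Adj S x t) (hs : s ∉ S) (hx : x ∈ V(A)) :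
    SpanPath A.Adj S x t ∧ S ⊆ V(A) := by
  have hm := h.mem.2.1
  have hin := h.inter
  have hadj := fun x y => h.union.adj_iff (x := x) (y := y)
  clear h
  induction hp with
  | nil t => exact ⟨.nil t, Set.singleton_subset_iff.2 hx⟩
  | @cons S x y t hxy hp hxS ih =>
    have hxB : x ∉ V(B) := fun hxB => by
      have : x ∈ ({s, t} : Set α) := hin ▸ ⟨hx, hxB⟩
      rcases this with rfl | rfl
      · exact hs (Or.inl rfl)
      · exact hxS hp.right_mem
    have hA : A.Adj x y := ((hadj x y).1 hxy).resolve_right fun h => hxB h.left_mem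
    obtain ⟨h1, h2⟩ := ih (fun h => hs (Or.inr h)) hA.right_mem hm hin
    exact ⟨.cons hA h1 hxS, Set.insert_subset hx h2⟩

lemma IsParallelJoin.spanPath_left_of_adj (h : IsParallelJoin A B G s t) {S : Set α} {y : α}
    (hsy : A.Adj s y) (hp : SpanPath G.Adj S y t) (hs : s ∉ S) (hS : V(G) = insert s S) :
    SpanPath A.Adj V(A) s t ∧ V(B) ⊆ {s, t} := by
  obtain ⟨h1, h2⟩ := h.spanPath_left_of_notMem hp hs hsy.right_mem
  have hGA : V(G) ⊆ V(A) := hS ▸ Set.insert_subset hsy.left_mem h2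
  have hAG : V(A) = insert s S :=
    hS ▸ Set.Subset.antisymm (h.union.vertexSet_eq ▸ Set.subset_union_left) hGA
  refine ⟨hAG ▸ .cons hsy h1 hs, fun b hb => ?_⟩
  rw [← h.inter]
  exact ⟨hGA (h.union.vertexSet_eq ▸ Or.inr hb), hb⟩

/-- The first edge decides the side on which the path stays; since it is spanning, the other side
has no inner vertices. -/
lemma IsParallelJoin.spanPath (h : IsParallelJoin A B G s t) (hp : SpanPath G.Adj V(G) s t) :
    SpanPath A.Adj V(A) s t ∧ V(B) ⊆ {s, t} ∨ V(A) ⊆ {s, t} ∧ SpanPath B.Adj V(B) s t := by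
  generalize hS : V(G) = S at hp
  cases hp with
  | nil => exact (h.ne rfl).elim
  | cons hsy hp hs =>
    rcases h.union.adj_iff.1 hsy with hA | hB
    · exact Or.inl (h.spanPath_left_of_adj hA hp hs hS)
    · exact Or.inr (h.symm.spanPath_left_of_adj hB hp hs hS).symm

lemma IsSeriesJoin.spanPath_left_of_notMem (h : IsSeriesJoin A B G s w t) {S : Set α} {x z : α}
    (hp : SpanPath G.Adj S x z) (hw : w ∉ S) (hx : x ∈ V(A)) :
    SpanPath A.Adj S x z ∧ S ⊆ V(A) := by
  induction hp with
  | nil x => exact ⟨.nil x, Set.singleton_subset_iff.2 hx⟩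
  | @cons S x y z hxy hp hxS ih =>
    have hxB : x ∉ V(B) := fun hxB => by
      have : x ∈ ({w} : Set α) := h.inter ▸ ⟨hx, hxB⟩
      rw [Set.mem_singleton_iff] at this
      exact hw (Or.inl this.symm)
    have hA : A.Adj x y := (h.union.adj_iff.1 hxy).resolve_right fun h => hxB h.left_mem
    obtain ⟨h1, h2⟩ := ih (fun h => hw (Or.inr h)) hA.right_mem
    exact ⟨.cons hA h1 hxS, Set.insert_subset hx h2⟩

/-- The path starts in `A` and ends outside it, so it passes through `w` and is cut there. -/
lemma IsSeriesJoin.exists_spanPath (h : IsSeriesJoin A B G s w t) {S : Set α} {x : α}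
    (hp : SpanPath G.Adj S x t) (hx : x ∈ V(A)) :
    ∃ S₁ S₂, S = S₁ ∪ S₂ ∧ S₁ ⊆ V(A) ∧ S₂ ⊆ V(B) ∧ SpanPath A.Adj S₁ x w ∧
      SpanPath B.Adj S₂ w t := by
  have ht : t ∉ V(A) := fun ht => by
    have : t ∈ ({w} : Set α) := h.inter ▸ ⟨ht, h.right_mem⟩
    exact h.right_ne this.symm
  generalize hz : t = z at hp
  induction hp with
  | nil x => exact (ht (hz ▸ hx)).elim
  | @cons S x y z hxy hp hxS ih =>
    by_cases hxw : x = w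
    · subst hxw
      rcases h.union.adj_iff.1 hxy with hA | hB
      · have := (h.spanPath_left_of_notMem hp hxS hA.right_mem).2 hp.right_mem
        exact (ht (hz ▸ this)).elim
      · obtain ⟨h1, h2⟩ := h.symm.spanPath_left_of_notMem hp hxS hB.right_mem
        exact ⟨{x}, insert x S, (Set.union_eq_right.2 (by simp)).symm,
          Set.singleton_subset_iff.2 hx, Set.insert_subset hB.left_mem h2, .nil x,
          .cons hB h1 hxS⟩
    · have hxB : x ∉ V(B) := fun hxB => hxw (h.inter ▸ ⟨hx, hxB⟩ : x ∈ ({w} : Set α))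
      have hA : A.Adj x y := (h.union.adj_iff.1 hxy).resolve_right fun h => hxB h.left_mem
      obtain ⟨S₁, S₂, h1, h2, h3, h4, h5⟩ := ih hA.right_mem hz
      refine ⟨insert x S₁, S₂, by rw [h1, Set.insert_union], Set.insert_subset hx h2, h3,
        .cons hA h4 fun h => hxS (h1 ▸ Or.inl h), h5⟩

lemma IsSeriesJoin.spanPath (h : IsSeriesJoin A B G s w t) (hp : SpanPath G.Adj V(G) s t) :
    SpanPath A.Adj V(A) s w ∧ SpanPath B.Adj V(B) w t := by
  obtain ⟨S₁, S₂, h1, h2, h3, h4, h5⟩ := h.exists_spanPath hp h.left_mem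
  rw [h.union.vertexSet_eq] at h1
  have hA : V(A) = S₁ := by
    refine Set.Subset.antisymm (fun a ha => ?_) h2
    rcases (h1 ▸ Or.inl ha : a ∈ S₁ ∪ S₂) with h' | h'
    · exact h'
    · have : a ∈ ({w} : Set α) := h.inter ▸ ⟨ha, h3 h'⟩
      exact (show a = w from this) ▸ h4.right_mem
  have hB : V(B) = S₂ := by
    refine Set.Subset.antisymm (fun a ha => ?_) h3
    rcases (h1 ▸ Or.inr ha : a ∈ S₁ ∪ S₂) with h' | h'
    · have : a ∈ ({w} : Set α) := h.inter ▸ ⟨h2 h', ha⟩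
      exact (show a = w from this) ▸ h5.left_mem
    · exact h'
  rw [hA, hB]
  exact ⟨h4, h5⟩

end Splitting

lemma Represents.isBanana {Y : SPTree β} {G : Graph α β} {s t : α} (h : Represents Y G s t)
    (hV : V(G) ⊆ {s, t}) : Y.IsBanana ∧ G.Adj s t := by
  induction h with
  | leaf => exact ⟨trivial, by simp⟩
  | series hl hr h =>
    rw [h.union.vertexSet_eq, Set.union_subset_iff] at hV
    rcases hV.1 h.mem.1 with h' | h'
    · exact (h.left_ne h'.symm).elim
    · exact (h.right_ne h').elim
  | parallel hl hr h ihl ihr =>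
    rw [h.union.vertexSet_eq, Set.union_subset_iff] at hV
    exact ⟨⟨(ihl hV.1).1, (ihr hV.2).1⟩, h.union.adj_iff.2 (Or.inl (ihl hV.1).2)⟩

lemma Represents.isHam {Y : SPTree β} {G : Graph α β} {s t : α} (h : Represents Y G s t)
    (hp : SpanPath G.Adj V(G) s t) : Y.IsHam := by
  induction h with
  | leaf => trivial
  | series hl hr h ihl ihr => exact ⟨ihl (h.spanPath hp).1, ihr (h.spanPath hp).2⟩
  | parallel hl hr h ihl ihr =>
    rcases h.spanPath hp with ⟨h1, h2⟩ | ⟨h1, h2⟩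
    · exact Or.inl ⟨ihl h1, (hr.isBanana h2).1⟩
    · exact Or.inr ⟨(hl.isBanana h1).1, ihr h2⟩

/-- A parallel root would have a side made of parallel edges, and a leaf is an edge; either makes
`s` and `t` adjacent. -/
lemma Represents.exists_series {Y : SPTree β} {G : Graph α β} {s t : α} (h : Represents Y G s t)
    (hp : SpanPath G.Adj V(G) s t) (hst : ¬ G.Adj s t) :
    ∃ l r, Y = .series l r ∧ l.IsHam ∧ r.IsHam := by
  have hY := h.isHam hp
  cases h with
  | leaf => exact (hst (by simp)).elim
  | series hl hr h => exact ⟨_, _, rfl, hY⟩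
  | parallel hl hr h =>
    rcases h.spanPath hp with ⟨_, h2⟩ | ⟨h1, _⟩
    · exact (hst (h.union.adj_iff.2 (Or.inr (hr.isBanana h2).2))).elim
    · exact (hst (h.union.adj_iff.2 (Or.inl (hl.isBanana h1).2))).elim

/-! ### Spanning paths of the pieces -/

lemma IsPath.spanPath {G : Graph α β} {s t : α} (h : IsPath G s t) :
    SpanPath G.Adj V(G) s t := by
  obtain ⟨n, -, x, e, hx, -, hV, hl, rfl, rfl⟩ := h
  have hof : ∀ i (hi : i < n + 1), Fin.ofNat (n + 1) i = ⟨i, hi⟩ := fun i hi =>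
    Fin.ext (Nat.mod_eq_of_lt hi)
  have := SpanPath.of_sequence (r := G.Adj) (p := fun i => x (Fin.ofNat (n + 1) i)) (n := n)
    (fun i hi j hj hij => by
      have := hx hij
      rw [hof i (Nat.lt_succ_of_le hi), hof j (Nat.lt_succ_of_le hj)] at this
      exact congrArg Fin.val this)
    (fun i hi => by
      refine ⟨e ⟨i, hi⟩, (hl _ _ _).2 ⟨_, rfl, ?_⟩⟩
      rw [hof i (by omega), hof (i + 1) (by omega)]
      rfl)
  convert this using 1
  · rw [hV]
    ext a
    simp only [Set.mem_range, Set.mem_image, Set.mem_Iic]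
    constructor
    · rintro ⟨i, rfl⟩
      exact ⟨i, Nat.lt_succ_iff.1 i.2, by rw [hof i i.2]⟩
    · rintro ⟨i, -, rfl⟩
      exact ⟨_, rfl⟩
  · rw [hof 0 (by omega)]; rfl
  · rw [hof n (by omega)]; rfl

lemma PlanarEmbedding.tail_face {G : Graph α β} (P : PlanarEmbedding G) (d : E(G) × Bool) :
    P.tail (P.face d) = P.tail (d.1, !d.2) := by
  rw [← P.sameCycle_rot_iff]
  exact (Equiv.Perm.sameCycle_apply_left (f := P.rot) (x := (d.1, !d.2))
    (y := (d.1, !d.2))).2 (Equiv.Perm.SameCycle.refl _ _)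

lemma PlanarEmbedding.isLink_face {G : Graph α β} (P : PlanarEmbedding G) (d : E(G) × Bool) :
    G.IsLink d.1 (P.tail d) (P.tail (P.face d)) := by
  rw [P.tail_face]
  obtain ⟨e, _ | _⟩ := d
  · exact P.isLink e
  · exact (P.isLink e).symm

/-- This is the boundary cycle of the face with the edge of `d` removed. -/
lemma PlanarEmbedding.IsHamiltonianFace.spanPath {G : Graph α β} {P : PlanarEmbedding G}
    {d : E(G) × Bool} (h : P.IsHamiltonianFace d) :
    SpanPath G.Adj V(G) (P.tail (P.face d)) (P.tail d) := by
  have hfin : Finite (E(G) × Bool) := by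
    have := P.finite_edgeSet.to_subtype
    infer_instance
  set k := Function.minimalPeriod P.face d with hk
  have hk0 : 0 < k := Function.minimalPeriod_pos_of_mem_periodicPts
    (P.face.injective.mem_periodicPts d)
  have hcyc : ∀ i : ℕ, P.face.SameCycle d (P.face^[i] d) := fun i => by
    rw [← Equiv.Perm.coe_pow]
    exact ⟨i, by simp⟩
  have hlast : P.face^[k - 1 + 1] d = d := by
    rw [Nat.sub_add_cancel hk0]
    exact Function.iterate_minimalPeriod
  -- The shift by one starts the walk at the head of `d`; the last dart, at index `k - 1`, is `d`
  -- again.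
  have := SpanPath.of_sequence (r := G.Adj) (p := fun i => P.tail (P.face^[i + 1] d)) (n := k - 1)
    (fun i hi j hj hij => by
      have h1 := h.1.injOn (hcyc _) (hcyc _) hij
      rw [Function.iterate_succ_apply', Function.iterate_succ_apply'] at h1
      rw [Set.mem_Iic] at hi hj
      exact Function.iterate_injOn_Iio_minimalPeriod (Set.mem_Iio.2 (by omega))
        (Set.mem_Iio.2 (by omega)) (P.face.injective h1))
    (fun i _ => by
      rw [Function.iterate_succ_apply' _ (i + 1)]
      exact (P.isLink_face _).adj)
  simp only [hlast] at this
  convert this using 1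
  swap
  · rfl
  ext a
  constructor
  · intro ha
    obtain ⟨d', hd', rfl⟩ := h.1.surjOn ha
    obtain ⟨i, hi⟩ := Equiv.Perm.SameCycle.exists_nat_pow_eq hd'
    rw [Equiv.Perm.coe_pow] at hi
    -- Because of the shift, the `i`-th dart has index `i - 1` modulo `k`.
    refine ⟨(i + (k - 1)) % k, Set.mem_Iic.2 (Nat.le_sub_one_of_lt (Nat.mod_lt _ hk0)), ?_⟩
    have : P.face^[(i + (k - 1)) % k + 1] d = P.face^[i] d := by
      rw [Function.iterate_succ_apply', Function.iterate_mod_minimalPeriod_eq,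
        ← Function.iterate_succ_apply' P.face, show (i + (k - 1)).succ = i + (k - 1 + 1) by omega,
        Function.iterate_add_apply, hlast]
    simp only [this, hi]
  · rintro ⟨i, -, rfl⟩
    exact h.1.mapsTo (hcyc _)

lemma HasHamiltonianFace.spanPath {G : Graph α β} {s t : α} (h : HasHamiltonianFace G s t) :
    SpanPath G.Adj V(G) s t := by
  obtain ⟨-, P, d, hd, hst⟩ := h
  rcases hst.eq_and_eq_or_eq_and_eq (P.isLink_face d) with ⟨rfl, rfl⟩ | ⟨rfl, rfl⟩
  · exact hd.spanPath.reverse fun _ _ h => h.symm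
  · exact hd.spanPath

lemma SeriesOfPieces.spanPath {n : ℕ} {G : Graph α β} {s t : α} (h : SeriesOfPieces n G s t) :
    SpanPath G.Adj V(G) s t := by
  induction h with
  | single h => exact h.elim (·.spanPath) (·.spanPath)
  | cons hA hB h ih =>
    rw [h.union.vertexSet_eq]
    refine ((hA.elim (·.spanPath) (·.spanPath)).mono fun a b hab => ?_).append
      (ih.mono fun a b hab => ?_) h.inter.subset
    · exact h.union.adj_iff.2 (Or.inl hab)
    · exact h.union.adj_iff.2 (Or.inr hab)

lemma SeriesOfPieces.not_adj {n : ℕ} {G : Graph α β} {s t : α} (h : SeriesOfPieces n G s t)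
    (hn : 2 ≤ n) : ¬ G.Adj s t := by
  cases h with
  | single => omega
  | @cons n A B _ _ w _ hA hB h =>
    rw [h.union.adj_iff]
    rintro (hst | hst)
    · have : t ∈ ({w} : Set α) := h.inter ▸ ⟨hst.right_mem, h.right_mem⟩
      exact h.right_ne this.symm
    · have : s ∈ ({w} : Set α) := h.inter ▸ ⟨h.left_mem, hst.left_mem⟩
      exact h.left_ne this

lemma IsCoHamiltonian.exists_series {H : Graph α β} {u v : α} (h : IsCoHamiltonian H u v) :
    ∃ l r : SPTree β, l.IsHam ∧ r.IsHam ∧ Represents (SPTree.series l r).dual H u v := by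
  obtain ⟨γ, D, s, t, n, Y, hn, hD, -, hY, hH⟩ := h
  obtain ⟨l, r, rfl, hl, hr⟩ := hY.exists_series hD.spanPath (hD.not_adj hn)
  exact ⟨l, r, hl, hr, hH⟩

/-! ### Cycles -/

/-- The graph with vertices `p 0, …, p n` in which the edge `c i` joins `p i` and `p (i + 1)`. -/
def segment (p : ℕ → α) (c : ℕ → β) (n : ℕ) (hc : Set.InjOn c (Set.Iio n)) : Graph α β where
  vertexSet := p '' Set.Iic n
  IsLink e x y := ∃ i < n, e = c i ∧ s(x, y) = s(p i, p (i + 1))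
  isLink_symm e _ := ⟨fun x y ⟨i, hi, h1, h2⟩ => ⟨i, hi, h1, by rw [Sym2.eq_swap, h2]⟩⟩
  eq_or_eq_of_isLink_of_isLink := by
    rintro e x y v w ⟨i, hi, rfl, h⟩ ⟨j, hj, hij, h'⟩
    rw [hc hi hj hij, ← h', Sym2.eq_iff] at h
    tauto
  left_mem_of_isLink := by
    rintro e x y ⟨i, hi, rfl, h⟩
    rcases Sym2.eq_iff.1 h with ⟨rfl, -⟩ | ⟨rfl, -⟩
    · exact ⟨i, Set.mem_Iic.2 (by omega), rfl⟩
    · exact ⟨i + 1, Set.mem_Iic.2 (by omega), rfl⟩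

lemma mem_edgeSet_segment {p : ℕ → α} {c : ℕ → β} {n : ℕ} {hc : Set.InjOn c (Set.Iio n)} {e : β} :
    e ∈ E(segment p c n hc) ↔ ∃ i < n, e = c i := by
  rw [Graph.edge_mem_iff_exists_isLink]
  constructor
  · rintro ⟨x, y, i, hi, h, -⟩
    exact ⟨i, hi, h⟩
  · rintro ⟨i, hi, h⟩
    exact ⟨p i, p (i + 1), i, hi, h, rfl⟩

/-- A path is an iterated series join of edges, hence the dual of a bundle of parallel edges. -/
lemma exists_represents_segment {p : ℕ → α} {c : ℕ → β} (n : ℕ)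
    (hp : Set.InjOn p (Set.Iic (n + 1))) (hc : Set.InjOn c (Set.Iio (n + 1))) :
    ∃ Y : SPTree β, Y.IsBanana ∧ Represents Y.dual (segment p c (n + 1) hc) (p 0) (p (n + 1)) := by
  have hpne : ∀ i j, i ≤ n + 1 → j ≤ n + 1 → i ≠ j → p i ≠ p j := fun i j hi hj hij h =>
    hij (hp hi hj h)
  induction n with
  | zero =>
    refine ⟨.leaf (c 0), trivial, ?_⟩
    have : segment p c (0 + 1) hc = Graph.banana (p 0) (p (0 + 1)) {c 0} := by
      refine Graph.ext ?_ fun e x y => ?_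
      · ext a
        simp only [segment, Graph.vertexSet_banana, Set.mem_image, Set.mem_Iic,
          Set.mem_insert_iff, Set.mem_singleton_iff]
        constructor
        · rintro ⟨i, hi, rfl⟩
          obtain rfl | rfl : i = 0 ∨ i = 0 + 1 := by omega
          · exact Or.inl rfl
          · exact Or.inr rfl
        · rintro (rfl | rfl)
          · exact ⟨0, by omega, rfl⟩
          · exact ⟨1, by omega, rfl⟩
      · simp only [segment, Graph.banana_isLink, Set.mem_singleton_iff]
        constructor
        · rintro ⟨i, hi, h⟩
          obtain rfl : i = 0 := by omega
          exact ⟨h.1, Sym2.eq_iff.1 h.2⟩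
        · rintro ⟨h1, h2⟩
          exact ⟨0, by omega, h1, Sym2.eq_iff.2 h2⟩
    rw [this]
    exact .leaf (hpne 0 1 (by omega) (by omega) (by omega))
  | succ n ih =>
    obtain ⟨Y, hY, hR⟩ := ih (hp.mono (Set.Iic_subset_Iic.2 (by omega)))
      (hc.mono (Set.Iio_subset_Iio (by omega)))
      (fun i j hi hj => hpne i j (by omega) (by omega))
    refine ⟨.parallel Y (.leaf (c (n + 1))), ⟨hY, trivial⟩, ?_⟩
    refine .series hR (.leaf (e := c (n + 1)) (s := p (n + 1)) (t := p (n + 1 + 1))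
      (hpne _ _ (by omega) (by omega) (by omega)))
      ⟨hpne _ _ (by omega) (by omega) (by omega), hpne _ _ (by omega) (by omega) (by omega),
        ⟨0, Set.mem_Iic.2 (by omega), rfl⟩, by simp, ?_, ?_, ?_, ?_⟩
    · ext a
      simp only [segment, Graph.vertexSet_banana, Set.mem_inter_iff, Set.mem_image, Set.mem_Iic,
        Set.mem_insert_iff, Set.mem_singleton_iff]
      constructor
      · rintro ⟨⟨i, hi, rfl⟩, h | h⟩
        · exact h
        · exact (hpne _ _ (by omega) (by omega) (by omega) h).elim
      · rintro rfl
        exact ⟨⟨n + 1, le_rfl, rfl⟩, Or.inl rfl⟩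
    · rw [Set.disjoint_left]
      intro e he he'
      obtain ⟨i, hi, rfl⟩ := mem_edgeSet_segment.1 he
      have := hc (Set.mem_Iio.2 (by omega)) (Set.mem_Iio.2 (by omega)) he'
      omega
    · ext a
      simp only [segment, Graph.vertexSet_banana, Set.mem_union, Set.mem_image, Set.mem_Iic,
        Set.mem_insert_iff, Set.mem_singleton_iff]
      constructor
      · rintro ⟨i, hi, rfl⟩
        rcases Nat.lt_or_ge i (n + 2) with h | h
        · exact Or.inl ⟨i, by omega, rfl⟩
        · obtain rfl : i = n + 1 + 1 := by omega
          exact Or.inr (Or.inr rfl)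
      · rintro (⟨i, hi, rfl⟩ | rfl | rfl)
        · exact ⟨i, by omega, rfl⟩
        · exact ⟨n + 1, by omega, rfl⟩
        · exact ⟨n + 1 + 1, by omega, rfl⟩
    · intro e x y
      simp only [segment, Graph.banana_isLink, Set.mem_singleton_iff]
      constructor
      · rintro ⟨i, hi, h⟩
        rcases Nat.lt_or_ge i (n + 1) with h' | h'
        · exact Or.inl ⟨i, h', h⟩
        · obtain rfl : i = n + 1 := by omega
          exact Or.inr ⟨h.1, Sym2.eq_iff.1 h.2⟩
      · rintro (⟨i, hi, h⟩ | ⟨h1, h2⟩)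
        · exact ⟨i, by omega, h⟩
        · exact ⟨n + 1, by omega, h1, Sym2.eq_iff.2 h2⟩

lemma natCast_zmod_injOn {n : ℕ} : Set.InjOn (fun i : ℕ => (i : ZMod n)) (Set.Iio n) := by
  intro i hi j hj hij
  have := (ZMod.natCast_eq_natCast_iff' i j n).1 hij
  rwa [Nat.mod_eq_of_lt hi, Nat.mod_eq_of_lt hj] at this

/-- `u = x a` and `v = x b` cut the cycle into an ascending arc of `k` edges and a descending arc of
`m + 1` edges, joined in parallel. -/
lemma IsCycle.exists_series {H : Graph α β} {u v : α} (h : IsCycle H) (hu : u ∈ V(H))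
    (hv : v ∈ V(H)) (huv : u ≠ v) :
    ∃ l r : SPTree β, l.IsHam ∧ r.IsHam ∧ Represents (SPTree.series l r).dual H u v := by
  obtain ⟨n, hn, x, e, hx, he, hV, hl⟩ := h
  have : NeZero n := ⟨by omega⟩
  rw [hV] at hu hv
  obtain ⟨a, rfl⟩ := hu
  obtain ⟨b, rfl⟩ := hv
  set k := (b - a).val with hk
  have hkn : k < n := ZMod.val_lt _
  have hkb : (k : ZMod n) = b - a := ZMod.natCast_zmod_val _
  have hk0 : k ≠ 0 := fun h0 => by
    rw [h0, Nat.cast_zero] at hkb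
    exact huv (by rw [sub_eq_zero.1 hkb.symm])
  obtain ⟨k', hk'⟩ : ∃ k', k = k' + 1 := Nat.exists_eq_succ_of_ne_zero hk0
  obtain ⟨m, hm⟩ : ∃ m, n = k + (m + 1) := ⟨n - k - 1, by omega⟩
  have hmb : ((m + 1 : ℕ) : ZMod n) = a - b := by
    have : ((k + (m + 1) : ℕ) : ZMod n) = 0 := by rw [← hm]; exact ZMod.natCast_self n
    rw [Nat.cast_add, hkb] at this
    linear_combination this
  have hcast : ∀ i j : ℕ, i < n → j < n → (i : ZMod n) = j → i = j := fun i j hi hj h =>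
    natCast_zmod_injOn hi hj h
  have hzero : ∀ i : ℕ, (i : ZMod n) = 0 → i ≤ n → i = 0 ∨ i = n := fun i h hi => by
    rw [ZMod.natCast_eq_zero_iff] at h
    rcases Nat.eq_zero_or_pos i with h0 | h0
    · exact Or.inl h0
    · exact Or.inr (le_antisymm hi (Nat.le_of_dvd h0 h))
  have hmn : m + 1 < n := by omega
  have hp₁ : Set.InjOn (fun i : ℕ => x (a + i)) (Set.Iic (k' + 1)) := fun i hi j hj h => by
    rw [Set.mem_Iic] at hi hj
    exact hcast i j (by omega) (by omega) (add_left_cancel (hx h))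
  have hc₁ : Set.InjOn (fun i : ℕ => e (a + i)) (Set.Iio (k' + 1)) := fun i hi j hj h => by
    rw [Set.mem_Iio] at hi hj
    exact hcast i j (by omega) (by omega) (add_left_cancel (he h))
  have hp₂ : Set.InjOn (fun i : ℕ => x (a - i)) (Set.Iic (m + 1)) := fun i hi j hj h => by
    rw [Set.mem_Iic] at hi hj
    exact hcast i j (by omega) (by omega) (sub_right_injective (hx h))
  -- The edge `e j` leads from `x j` to `x (j + 1)`, so a descending step from `x (a - i)` uses `e
  -- (a - i - 1)`.
  have hc₂ : Set.InjOn (fun i : ℕ => e (a - i - 1)) (Set.Iio (m + 1)) := fun i hi j hj h => by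
    rw [Set.mem_Iio] at hi hj
    exact hcast i j (by omega) (by omega) (sub_right_injective (sub_left_injective (he h)))
  obtain ⟨l, hl', hL⟩ := exists_represents_segment k' hp₁ hc₁
  obtain ⟨r, hr', hR⟩ := exists_represents_segment m hp₂ hc₂
  have e1 : a + ((k' + 1 : ℕ) : ZMod n) = b := by rw [← hk', hkb]; ring
  have e2 : a - ((m + 1 : ℕ) : ZMod n) = b := by rw [hmb]; ring
  simp only [Nat.cast_zero, add_zero, sub_zero, e1, e2] at hL hR
  refine ⟨l, r, hl'.isHam, hr'.isHam, .parallel hL hR ⟨huv, ?_, ?_, ?_, ?_⟩⟩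
  · refine Set.Subset.antisymm ?_ ?_
    · rintro _ ⟨⟨i, hi, rfl⟩, j, hj, hij⟩
      rw [Set.mem_Iic] at hi hj
      have h0 : ((i + j : ℕ) : ZMod n) = 0 := by
        have := hx hij
        push_cast
        linear_combination -this
      rcases hzero _ h0 (by omega) with h | h
      · obtain rfl : i = 0 := by omega
        simp
      · obtain rfl : i = k' + 1 := by omega
        simp only [e1]
        exact Or.inr rfl
    · rintro _ (rfl | rfl)
      · exact ⟨hL.mem.1, hR.mem.1⟩
      · exact ⟨hL.mem.2, hR.mem.2⟩
  · rw [Set.disjoint_left]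
    intro c h1 h2
    obtain ⟨i, hi, rfl⟩ := mem_edgeSet_segment.1 h1
    obtain ⟨j, hj, hij⟩ := mem_edgeSet_segment.1 h2
    have h0 : ((i + j + 1 : ℕ) : ZMod n) = 0 := by
      have := he hij
      push_cast
      linear_combination this
    rcases hzero _ h0 (by omega) with h | h <;> omega
  · rw [hV]
    refine Set.Subset.antisymm ?_ ?_
    · rintro _ ⟨j, rfl⟩
      have hj : ((j - a).val : ZMod n) = j - a := ZMod.natCast_zmod_val _
      have hjn : (j - a).val < n := ZMod.val_lt _
      by_cases hjk : (j - a).val ≤ k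
      · exact Or.inl ⟨(j - a).val, Set.mem_Iic.2 (by omega), by simp [hj]⟩
      · refine Or.inr ⟨n - (j - a).val, Set.mem_Iic.2 (by omega), ?_⟩
        simp only [Nat.cast_sub hjn.le, hj, ZMod.natCast_self]
        congr 1
        ring
    · rintro _ (⟨i, -, rfl⟩ | ⟨i, -, rfl⟩) <;> exact ⟨_, rfl⟩
  · intro c y z
    rw [hl]
    constructor
    · rintro ⟨j, rfl, hyz⟩
      have hj : ((j - a).val : ZMod n) = j - a := ZMod.natCast_zmod_val _
      have hjn : (j - a).val < n := ZMod.val_lt _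
      by_cases hjk : (j - a).val < k
      · refine Or.inl ⟨(j - a).val, by omega, by simp [hj], ?_⟩
        rw [hyz]
        push_cast
        rw [hj]
        exact congrArg₂ (fun i j => s(x i, x j)) (by ring) (by ring)
      · refine Or.inr ⟨n - 1 - (j - a).val, by omega, ?_, ?_⟩
        · simp only [Nat.sub_sub, Nat.cast_sub (show 1 + (j - a).val ≤ n by omega), Nat.cast_add, hj,
            ZMod.natCast_self, Nat.cast_one]
          congr 1
          ring
        · rw [hyz, Sym2.eq_swap]
          simp only [Nat.sub_sub, Nat.cast_sub (show 1 + (j - a).val ≤ n by omega), Nat.cast_add, hj,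
            ZMod.natCast_self, Nat.cast_one]
          exact congrArg₂ (fun i j => s(x i, x j)) (by ring) (by ring)
    · rintro (⟨i, -, rfl, h⟩ | ⟨i, -, rfl, h⟩)
      · refine ⟨_, rfl, h.trans ?_⟩
        push_cast
        rw [add_assoc]
      · refine ⟨_, rfl, h.trans ?_⟩
        rw [Sym2.eq_swap]
        push_cast
        exact congrArg₂ (fun i j => s(x i, x j)) (by ring) (by ring)

/-! ### Condition 1 -/

/-- By the chain rule, an ideal containing the partial derivatives of `p` contains `D p` for every
derivation `D`. -/
lemma derivation_eq_sum_pderiv {E : Finset β} {p : MvPolynomial β ℚ}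
    (hp : p ∈ supported ℚ (E : Set β))
    (D : Derivation ℚ (MvPolynomial β ℚ) (MvPolynomial β ℚ)) :
    D p = ∑ j ∈ E, D (X j) * pderiv j p := by
  classical
  have sum_apply : ∀ q : MvPolynomial β ℚ, (∑ j ∈ E, D (X j) • pderiv j :
      Derivation ℚ (MvPolynomial β ℚ) (MvPolynomial β ℚ)) q = ∑ j ∈ E, D (X j) * pderiv j q :=
    fun q => by
      rw [← Derivation.coeFnAddMonoidHom_apply, map_sum, Finset.sum_apply]
      rfl
  have h : Set.EqOn (D ∘ X) ((∑ j ∈ E, D (X j) • pderiv j :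
      Derivation ℚ (MvPolynomial β ℚ) (MvPolynomial β ℚ)) ∘ X) (E : Set β) := by
    intro i hi
    rw [Function.comp_apply, Function.comp_apply, sum_apply]
    rw [Finset.sum_eq_single_of_mem i hi fun j _ hj => by rw [pderiv_X_of_ne hj.symm, mul_zero]]
    simp
  have := derivation_eqOn_supported h hp
  rw [this, sum_apply]

/-- The indicator of a component is a potential, hence constant. -/
lemma numComponents_eq_one {G : Graph α β} (hne : V(G).Nonempty) (h : Connects G E(G)) :
    numComponents G = 1 := by
  classical
  have : Nonempty (Quot fun x y : V(G) => G.Adj x y) := ⟨Quot.mk _ ⟨_, hne.some_mem⟩⟩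
  have : Subsingleton (Quot fun x y : V(G) => G.Adj x y) := by
    refine ⟨fun p q => ?_⟩
    induction p using Quot.ind with | mk x => ?_
    induction q using Quot.ind with | mk y => ?_
    let f : α → ℚ := fun z => if hz : z ∈ V(G) then
      if Quot.mk (fun x y : V(G) => G.Adj x y) ⟨z, hz⟩ = Quot.mk _ x then 1 else 0 else 0
    have hf : Respects G E(G) f := by
      intro e _ z w hzw
      have : Quot.mk (fun x y : V(G) => G.Adj x y) ⟨z, hzw.left_mem⟩ =
          Quot.mk _ ⟨w, hzw.right_mem⟩ := Quot.sound ⟨e, hzw⟩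
      simp only [f, hzw.left_mem, hzw.right_mem, dif_pos, this]
    have := h f hf x x.2 y y.2
    by_contra hn
    simp only [f, x.2, y.2, dif_pos, Ne.symm hn, if_true, if_false] at this
    exact one_ne_zero this
  exact Nat.card_unique

lemma isTree_deleteEdges_iff {G : Graph α β} {e : β} {T : Finset β} (he : e ∉ T) :
    IsTree (G.deleteEdges {e}) T ↔ IsTree G T := by
  have : ∀ f, Respects (G.deleteEdges {e}) T f ↔ Respects G T f := fun f => by
    refine ⟨fun h c hc x y hxy => h c hc x y ?_, fun h c hc x y hxy => h c hc x y ?_⟩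
    · rw [Graph.deleteEdges_isLink]
      exact ⟨hxy, fun h => he (h ▸ hc)⟩
    · rw [Graph.deleteEdges_isLink] at hxy
      exact hxy.1
  simp only [IsTree, Connects, this, Graph.vertexSet_deleteEdges]

open Classical in
/-- The derivatives of `∂Ψ/∂tₑ` generate the ideal of condition 1. -/
lemma condition1_of_forall_ideal {G : Graph α β} (hV : V(G).Finite) (hne : V(G).Nonempty)
    {E : Finset β} (hE : (E : Set β) = E(G)) {e : β} (he : e ∈ E) (hloop : 2 ≤ loopNumber G)
    (h : ∀ I : Ideal (MvPolynomial β ℚ), pderiv e (complPoly E (IsTree G)) ∈ I →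
      (∀ F : Derivation ℚ (MvPolynomial β ℚ) (MvPolynomial β ℚ),
        F (pderiv e (complPoly E (IsTree G))) ∈ I) → complPoly E (IsTree G) ∈ I) :
    Condition1 G e := by
  have hE' : ((E.erase e : Finset β) : Set β) = E(G.deleteEdges {e}) := by
    rw [Finset.coe_erase, hE, Graph.edgeSet_deleteEdges]
  have hk : kirchhoff (G.deleteEdges {e}) = pderiv e (complPoly E (IsTree G)) := by
    rw [kirchhoff_eq (G := G.deleteEdges {e}) hV hne hE', pderiv_complPoly _ he]
    exact complPoly_congr fun T hT =>
      isTree_deleteEdges_iff fun h => (Finset.mem_erase.1 (hT h)).1 rfl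
  rw [Condition1, hk, kirchhoff_eq hV hne hE]
  set I := Ideal.span ((fun j => pderiv j (pderiv e (complPoly E (IsTree G)))) ''
    E(G.deleteEdges {e})) with hI
  have hF : ∀ F : Derivation ℚ (MvPolynomial β ℚ) (MvPolynomial β ℚ),
      F (pderiv e (complPoly E (IsTree G))) ∈ I := fun F => by
    rw [derivation_eq_sum_pderiv (E := E.erase e)
      (by rw [pderiv_complPoly _ he]; exact complPoly_mem_supported _ _) F]
    exact sum_mem fun j hj => I.mul_mem_left _
      (Ideal.subset_span ⟨j, hE' ▸ Finset.mem_coe.2 hj, rfl⟩)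
  refine h I ?_ hF
  by_cases hc : Connects G E(G)
  · have hn := numComponents_eq_one hne hc
    rw [loopNumber, hn, ← hE, Set.ncard_coe_finset] at hloop
    -- The Euler derivation multiplies `∂ₑΨ` by its degree, the loop number minus 1, which is
    -- invertible in `ℚ`.
    have hEu := hF (mkDerivation ℚ X)
    rw [pderiv_complPoly _ he, derivation_complPoly
      (c := C (((E.erase e).card : ℚ) + 1 - V(G).ncard)) (fun j _ => mkDerivation_X _ _ _)] at hEu
    · rw [pderiv_complPoly _ he]
      have hcard : ((E.erase e).card : ℚ) + 1 = E.card := by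
        exact_mod_cast Finset.card_erase_add_one he
      have h0 : ((E.erase e).card : ℚ) + 1 - V(G).ncard ≠ 0 := by
        rw [hcard]
        have : (2 : ℚ) ≤ (E.card : ℚ) - V(G).ncard + 1 := by exact_mod_cast hloop
        intro h
        linarith
      have := I.mul_mem_left (C (((E.erase e).card : ℚ) + 1 - V(G).ncard)⁻¹) hEu
      rwa [← mul_assoc, ← C_mul, inv_mul_cancel₀ h0, C_1, one_mul] at this
    · intro T _ hT
      rw [← hT.2]
      simp
  -- A disconnected graph has no spanning trees, so `∂ₑΨ = 0`.
  · rw [pderiv_complPoly _ he, complPoly, Finset.sum_eq_zero]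
    · exact I.zero_mem
    · intro T hT
      simp only [Finset.mem_filter, Finset.mem_powerset] at hT
      refine (hc fun f hf => hT.2.1 f fun c hc => hf c ?_).elim
      rw [← hE]
      exact Finset.erase_subset _ _ (hT.1 hc)

lemma condition1_of_represents {A H G : Graph α β} {u v : α} (hV : V(A).Finite) (hE : E(A).Finite)
    (hG : IsParallelJoin A H G u v) (hloop : 2 ≤ loopNumber G) {l r : SPTree β} (hl : l.IsHam)
    (hr : r.IsHam) (hH : Represents (SPTree.series l r).dual H u v) {e : β} (he : e ∈ E(H)) :
    Condition1 G e := by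
  classical
  obtain ⟨EH, hEH, h1, h2⟩ := hH.complPoly_dual
  have hVH := hH.finite_vertexSet
  have hEA := hE.coe_toFinset
  have hmem : e ∈ l.edges ∪ r.edges := by
    rwa [hH.edgeSet_eq, SPTree.edges_dual] at he
  have hdis : Disjoint E(A) (l.edges ∪ r.edges) := by
    have := hG.union.disjoint_edges
    rwa [hH.edgeSet_eq, SPTree.edges_dual] at this
  have hnot : ∀ j ∈ l.edges ∪ r.edges, j ∉ E(A) := fun j hj hj' => Set.disjoint_left.1 hdis hj' hj
  cases hH with
  | parallel hl' hr' hj =>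
    have hlr := hj.union.disjoint_edges
    rw [hl'.edgeSet_eq, hr'.edgeSet_eq, SPTree.edges_dual, SPTree.edges_dual] at hlr
    have hL := hl.hamPair hl'
    have hR := hr.hamPair hr'
    refine condition1_of_forall_ideal (E := hE.toFinset ∪ EH)
      (by rw [hG.union.vertexSet_eq]; exact hV.union hVH)
      ⟨u, hG.union.vertexSet_eq ▸ Or.inl hG.mem.1⟩
      (by rw [Finset.coe_union, hEA, hEH, hG.union.edgeSet_eq])
      (Finset.mem_union_right _ (Finset.mem_coe.1 (hEH ▸ he))) hloop fun I => ?_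
    rw [hG.complPoly_isTree hEA hEH hV hVH, h1, h2]
    set g := complPoly hE.toFinset (IsTree A)
    set g' := complPoly hE.toFinset (IsTwoForest A u v)
    have hsub : (hE.toFinset : Set β) ⊆ (l.edges ∪ r.edges)ᶜ := by
      rw [hEA]; exact fun j hj hj' => hnot j hj' hj
    have hg : g ∈ supported ℚ (l.edges ∪ r.edges)ᶜ :=
      supported_mono hsub (complPoly_mem_supported _ _)
    have hg' : g' ∈ supported ℚ (l.edges ∪ r.edges)ᶜ :=
      supported_mono hsub (complPoly_mem_supported _ _)
    -- The Euler derivation in the variables of `A` only; `c` below is the degree of `g`, and `g'`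
    -- has degree `c + 1`.
    let D : Derivation ℚ (MvPolynomial β ℚ) (MvPolynomial β ℚ) :=
      mkDerivation ℚ (E(A).indicator X)
    have hD : ∀ j ∈ l.edges ∪ r.edges, D (X j) = 0 := fun j hj => by
      rw [mkDerivation_X, Set.indicator_of_notMem (hnot j hj)]
    have hDE : ∀ j ∈ hE.toFinset, D (X j) = X j := fun j hj => by
      rw [mkDerivation_X, Set.indicator_of_mem (hE.mem_toFinset.1 hj)]
    let c : MvPolynomial β ℚ := (hE.toFinset.card : MvPolynomial β ℚ) + 1 - V(A).ncard
    have hDg : D g = c * g := derivation_complPoly hDE fun T _ hT => by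
      simp only [c, ← hT.2]; push_cast; ring
    have hDg' : D g' = (c + 1) * g' := derivation_complPoly hDE fun T _ hT => by
      simp only [c, ← hT.2]; push_cast; ring
    rcases hmem with hm | hm
    · exact hL.mem_ideal_of_series hR hlr hg hg' hD hDg hDg' hm
    -- The polynomial is symmetric in the two series factors, so they may trade roles.
    · rw [Set.union_comm] at hg hg' hD
      have := fun hI => hR.mem_ideal_of_series hL hlr.symm hg hg' hD hDg hDg' hm (I := I) hI
      convert this using 2 <;> simp only [SPTree.polys] <;> ring_nf

end CondOne

theorem mainTheorem9 {α β : Type*} (G H G' : Graph α β) (f : β) (u v : α)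
    (hVfin : V(G).Finite) (hEfin : E(G).Finite)
    (hH : CondOne.IsCycle H ∨ CondOne.IsCoHamiltonian H u v)
    (hG' : CondOne.IsReplacement G f H G' u v)
    (hloop : 2 ≤ CondOne.loopNumber G') :
    ∀ e ∈ E(H), CondOne.Condition1 G' e := by
  intro e he
  obtain ⟨-, hj⟩ := hG'
  obtain ⟨l, r, hl, hr, hR⟩ : ∃ l r : CondOne.SPTree β, l.IsHam ∧ r.IsHam ∧
      CondOne.Represents (CondOne.SPTree.series l r).dual H u v := by
    rcases hH with h | h
    · exact h.exists_series hj.mem.2.2.1 hj.mem.2.2.2 hj.ne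
    · exact h.exists_series
  refine CondOne.condition1_of_represents (A := G.deleteEdges {f}) hVfin ?_ hj hloop hl hr hR he
  rw [Graph.edgeSet_deleteEdges]
  exact hEfin.sdiff
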